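/- Let $P_n^\bullet$ be the disc with $n\ge 1$ marked points $v_0,\dots,v_{n-1}$ on its boundary (numbered clockwise, indices modulo $n$) and one marked interior point $\bullet$, the puncture. An arc is an isotopy class of non-self-intersecting curves with endpoints in the set of marked points, neither contractible nor isotopic to a boundary segment between consecutive marked points; arcs incident to $\bullet$ are called spokes. For $m\ge 1$, an $(m+2)$-angulation of $P_n^\bullet$ is a set $T$ of pairwise non-crossing arcs such that every connected component of $P_n^\bullet\setminus T$ is an $(m+2)$-gon. Let $\mathcal T_{n,s}^{\bullet,(m)}$ be the set of $(m+2)$-angulations of $P_n^\bullet$ with exactly $s$ spokes. The cyclic group $G_n=\langle\sigma\rangle$ of order $n$ acts on it by rotation, $\sigma: v_i\mapsto v_{i-1}$. For $m\mid n$ put $$t_{n,s}^{(m)}(q)=m\begin{bmatrix} n+\frac nm-s-1\\ n-1\end{bmatrix}_q\in\mathbb Z[q],$$ a Gaussian binomial coefficient, understood to be $0$ when its top entry is less than its bottom entry (that is, when $s>n/m$). Let $n,m,s$ be positive integers with $m\mid n$, and put $\ell=n/m$. (a) Suppose that for every divisor $d$ of $n$, $s\equiv \ell\pmod d$ implies $s\equiv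 0\pmod d$. Then $(\mathcal T_{n,s}^{\bullet,(m)},G_n,t_{n,s}^{(m)}(q))$ exhibits the cyclic sieving phenomenon: the set $\mathcal T_{n,s}^{\bullet,(m)}$ is finite and, for every primitive $n$-th root of unity $\zeta_n$ and every integer $k\ge 0$, $t_{n,s}^{(m)}(\zeta_n^k)$ is the number of elements of $\mathcal T_{n,s}^{\bullet,(m)}$ fixed by $\sigma^k$. (b) More generally, let $d$ be a divisor of $n$ such that $s$ and $\ell$ are not congruent to the same nonzero residue modulo $d$. Then for every primitive $d$-th root of unity $\zeta_d$, $t_{n,s}^{(m)}(\zeta_d)$ is the number of elements of $\mathcal T_{n,s}^{\bullet,(m)}$ fixed by $\sigma^{n/d}$. -/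

import Mathlib

open scoped Pointwise

/-! ### Gaussian binomial coefficients -/

/-- The `q`-integer `[n]_q = 1 + q + ⋯ + q^(n-1)`. -/
noncomputable def qNumber (n : ℕ) : Polynomial ℤ := ∑ i ∈ Finset.range n, Polynomial.X ^ i

/-- The `q`-factorial `[n]_q! = [1]_q [2]_q ⋯ [n]_q`. -/
noncomputable def qFactorial (n : ℕ) : Polynomial ℤ := ∏ i ∈ Finset.range n, qNumber (i + 1)

/-- The Gaussian binomial coefficient as a polynomial in `q`, through the `q`-Pascal recursion.
It is `0` for `n < k`, and equals `[n]_q! / ([k]_q! [n-k]_q!)` for `k ≤ n`: see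
`qBinomial_mul_qFactorial`. -/
noncomputable def qBinomial : ℕ → ℕ → Polynomial ℤ
  | _, 0 => 1
  | 0, _ + 1 => 0
  | n + 1, k + 1 => qBinomial n k + Polynomial.X ^ (k + 1) * qBinomial n (k + 1)

theorem qBinomial_eq_zero_of_lt : ∀ {n k : ℕ}, n < k → qBinomial n k = 0
  | _, 0, h => absurd h (Nat.not_lt_zero _)
  | 0, _ + 1, _ => by simp [qBinomial]
  | n + 1, k + 1, h => by
      simp [qBinomial, qBinomial_eq_zero_of_lt (Nat.lt_of_succ_lt_succ h),
        qBinomial_eq_zero_of_lt (Nat.lt_of_succ_lt h)]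

theorem qNumber_add (a b : ℕ) :
    qNumber (a + b) = qNumber a + Polynomial.X ^ a * qNumber b := by
  simp [qNumber, Finset.sum_range_add, Finset.mul_sum, pow_add]

theorem qFactorial_succ (n : ℕ) : qFactorial (n + 1) = qFactorial n * qNumber (n + 1) := by
  simp [qFactorial, Finset.prod_range_succ]

/-- The recursive definition agrees with the quotient of `q`-factorials. -/
theorem qBinomial_mul_qFactorial (k j : ℕ) :
    qBinomial (k + j) k * (qFactorial k * qFactorial j) = qFactorial (k + j) := by
  induction k generalizing j with
  | zero => simp [qBinomial, qFactorial]
  | succ k ihk =>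
    induction j with
    | zero =>
      have h := ihk 0
      simp only [Nat.add_zero] at h ⊢
      rw [qBinomial, qBinomial_eq_zero_of_lt (Nat.lt_succ_self k), qFactorial_succ]
      linear_combination qNumber (k + 1) * h
    | succ j ihj =>
      have h := ihk (j + 1)
      have e1 : k + 1 + (j + 1) = (k + (j + 1)) + 1 := by omega
      have e2 : k + 1 + j = k + (j + 1) := by omega
      rw [e2] at ihj
      rw [e1, qBinomial, qFactorial_succ (k + (j + 1))]
      have e3 : qNumber (k + (j + 1) + 1) = qNumber (k + 1) +
          Polynomial.X ^ (k + 1) * qNumber (j + 1) := by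
        rw [← qNumber_add]; congr 1; omega
      rw [e3]
      rw [qFactorial_succ k] at ihj ⊢
      rw [qFactorial_succ j] at h ⊢
      linear_combination qNumber (k + 1) * h + Polynomial.X ^ (k + 1) * qNumber (j + 1) * ihj

/-- The polynomial `t_{n,s}^{(m)}(q) = m * [n + n/m - s - 1 choose n - 1]_q`, where the Gaussian
binomial is `0` when its top entry (an integer) is less than its bottom entry, that is,
for `n/m < s`. -/
noncomputable def spokePolynomial (n m s : ℕ) : Polynomial ℤ :=
  if s ≤ n / m then (m : Polynomial ℤ) * qBinomial (n + n / m - s - 1) (n - 1) else 0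

/-! ### The cyclic sieving phenomenon -/

/-- `(X, G, f)` exhibits the cyclic sieving phenomenon, where `G = ⟨σ⟩` is a cyclic group of
order `n` acting on the finite set `X`: for every `k`, the value of `f` at `ζ ^ k`, with `ζ` a
primitive `n`-th root of unity, is the number of fixed points of `σ ^ k`. -/
def ExhibitsCSP {G : Type*} [Group G] (X : Type*) [MulAction G X] (n : ℕ) (σ : G)
    (f : Polynomial ℤ) : Prop :=
  (∀ g : G, g ∈ Subgroup.zpowers σ) ∧ orderOf σ = n ∧ Finite X ∧
    ∀ ζ : ℂ, IsPrimitiveRoot ζ n → ∀ k : ℕ,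
      Polynomial.aeval (ζ ^ k) f = (Nat.card (MulAction.fixedBy X (σ ^ k)) : ℂ)

/-! ### Arcs of the once-punctured polygon -/

/-- The arcs (up to isotopy) of the once-punctured `n`-gon with boundary vertices `v_i`, `i` in
`ℤ/n`, numbered clockwise:
* `spoke i` joins `v_i` to the puncture;
* `chord i j` is the arc `(v_i, v_j)` which runs from `v_i` to `v_j` clockwise around the
  puncture, so that it separates the puncture from the boundary vertices
  `v_{i+1}, …, v_{j-1}`.  For `i = j` this is the loop at `v_i` that cuts out a punctured
  monogon.  The boundary edges `(v_i, v_{i+1})` are not counted as arcs. -/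
inductive PuncturedArc (n : ℕ) : Type
  | spoke (i : ZMod n) : PuncturedArc n
  | chord (i j : ZMod n) (h : j ≠ i + 1) : PuncturedArc n

namespace PuncturedArc

/-- The lifts of an arc to the universal cover of the punctured polygon.  The cover is a polygon
with vertex set `ℤ ∪ {⊤}`: the integer `a` lies over `v_{a mod n}`, and `⊤` lies over the puncture;
the deck transformations are the translations by multiples of `n`.  A curve in the
cover between two distinct vertices is determined up to isotopy by its endpoints, and is recorded
as the pair `(x, y)` of its endpoints, with `x < y`. -/
def lifts {n : ℕ} : PuncturedArc n → Set (WithTop ℤ × WithTop ℤ)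
  | spoke i => {e | ∃ a : ℤ, (a : ZMod n) = i ∧ e = ((a : WithTop ℤ), ⊤)}
  | chord i j _ => {e | ∃ a b : ℤ, (a : ZMod n) = i ∧ (b : ZMod n) = j ∧ a < b ∧ b ≤ a + n ∧
      e = ((a : WithTop ℤ), (b : WithTop ℤ))}

/-- Two arcs cross if some lifts of theirs have interleaved endpoints; otherwise
their isotopy classes have representatives that do not cross. -/
def Crosses {n : ℕ} (α β : PuncturedArc n) : Prop :=
  ∃ e ∈ α.lifts, ∃ f ∈ β.lifts,
    (e.1 < f.1 ∧ f.1 < e.2 ∧ e.2 < f.2) ∨ (f.1 < e.1 ∧ e.1 < f.2 ∧ f.2 < e.2)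

end PuncturedArc

/-- The lifts of all arcs in `T`. -/
def liftedArcs {n : ℕ} (T : Set (PuncturedArc n)) : Set (WithTop ℤ × WithTop ℤ) :=
  ⋃ α ∈ T, α.lifts

/-- The lifts of all boundary edges `(v_i, v_{i+1})`. -/
def liftedBoundary : Set (WithTop ℤ × WithTop ℤ) :=
  {e | ∃ a : ℤ, e = ((a : WithTop ℤ), ((a + 1 : ℤ) : WithTop ℤ))}

/-- Let `E` be the set of all lifts of arcs of a non-crossing set `T` and of boundary edges.
The finite vertex set `S` spans a (lifted) component of the complement of `T` when
any two vertices of `S` that are cyclically adjacent in `S` are joined by an element of `E` (a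
side), and no other two vertices of `S` are joined by an element of `E` (no arc runs through
the interior).  Two vertices `x < y` of `S` are adjacent when no vertex of `S` lies
strictly between them, or when they are the least and the greatest vertex of `S`. -/
def IsCell (E : Set (WithTop ℤ × WithTop ℤ)) (S : Finset (WithTop ℤ)) : Prop :=
  ∀ x ∈ S, ∀ y ∈ S, x < y →
    ((x, y) ∈ E ↔ (∀ z ∈ S, ¬ (x < z ∧ z < y)) ∨ (∀ z ∈ S, x ≤ z ∧ z ≤ y))

/-- `T` is an `(m+2)`-angulation of the once-punctured `n`-gon: its arcs are pairwise non-crossing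
and every component of the complement of `T` is an `(m+2)`-gon.  Every
component has a side; so the second condition says that the components on both sides of every
arc of `T`, and the component at every boundary edge, are `(m+2)`-gons.  The component on the
one side of the lift `(x, y)` of an arc has all its vertices in `[x, y]`, the one on the other
side (for a boundary edge: the only one) has none strictly between `x` and `y`.
A component that contains the puncture in its interior lifts to a region with
infinitely many vertices, so it is not counted as a polygon. -/
def IsAngulation {n : ℕ} (m : ℕ) (T : Set (PuncturedArc n)) : Prop :=
  (∀ α ∈ T, ∀ β ∈ T, ¬ α.Crosses β) ∧
  (∀ x y, (x, y) ∈ liftedArcs T →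
    ∃ S : Finset (WithTop ℤ), IsCell (liftedArcs T ∪ liftedBoundary) S ∧ S.card = m + 2 ∧
      x ∈ S ∧ y ∈ S ∧ ∀ z ∈ S, x ≤ z ∧ z ≤ y) ∧
  (∀ x y, (x, y) ∈ liftedArcs T ∪ liftedBoundary →
    ∃ S : Finset (WithTop ℤ), IsCell (liftedArcs T ∪ liftedBoundary) S ∧ S.card = m + 2 ∧
      x ∈ S ∧ y ∈ S ∧ ∀ z ∈ S, ¬ (x < z ∧ z < y))

/-- The number of spokes of `T`. -/
noncomputable def spokeCount {n : ℕ} (T : Set (PuncturedArc n)) : ℕ :=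
  Set.ncard {i : ZMod n | PuncturedArc.spoke i ∈ T}

/-- The set of `(m+2)`-angulations of the once-punctured `n`-gon with exactly `s` spokes. -/
def SpokeAngulation (n m s : ℕ) : Type :=
  {T : Set (PuncturedArc n) // IsAngulation m T ∧ spokeCount T = s}

/-! ### The action by rotations -/

/-- The group of rotations of the `n`-gon, cyclic of order `n`, written multiplicatively. -/
abbrev RotationGroup (n : ℕ) : Type := Multiplicative (ZMod n)

/-- The generator `σ` of the rotation group; it acts by `v_i ↦ v_{i-1}`. -/
def rotationGenerator (n : ℕ) : RotationGroup n := Multiplicative.ofAdd 1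

namespace PuncturedArc

/-- The action of the rotations on arcs, induced by `σ • v_i = v_{i-1}`. -/
instance {n : ℕ} : MulAction (RotationGroup n) (PuncturedArc n) where
  smul g α := match α with
    | spoke i => spoke (i - g.toAdd)
    | chord i j h => chord (i - g.toAdd) (j - g.toAdd)
        (fun h' => h (by linear_combination h'))
  one_smul α := by
    cases α with
    | spoke i => exact congrArg spoke (sub_zero i)
    | chord i j h =>
      change chord (i - 0) (j - 0) _ = _
      simp only [sub_zero]
  mul_smul g g' α := by
    cases α with
    | spoke i =>
      change spoke (i - (g.toAdd + g'.toAdd)) = spoke (i - g'.toAdd - g.toAdd)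
      congr 1; ring
    | chord i j h =>
      change chord (i - (g.toAdd + g'.toAdd)) (j - (g.toAdd + g'.toAdd)) _ =
        chord (i - g'.toAdd - g.toAdd) (j - g'.toAdd - g.toAdd) _
      congr 1 <;> ring

theorem smul_spoke {n : ℕ} (g : RotationGroup n) (i : ZMod n) :
    g • spoke i = spoke (i - g.toAdd) := rfl

theorem smul_chord {n : ℕ} (g : RotationGroup n) (i j : ZMod n) (h : j ≠ i + 1) :
    g • chord i j h = chord (i - g.toAdd) (j - g.toAdd)
      (fun h' => h (by linear_combination h')) := rfl

end PuncturedArc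

/-- Translation by `c` of the vertices `ℤ ∪ {⊤}` of the universal cover, fixing `⊤`. -/
noncomputable def coverShift (c : ℤ) : WithTop ℤ ≃o WithTop ℤ := (OrderIso.addRight c).withTopCongr

theorem coverShift_coe (c a : ℤ) : coverShift c (a : WithTop ℤ) = ((a + c : ℤ) : WithTop ℤ) := rfl

theorem coverShift_top (c : ℤ) : coverShift c ⊤ = ⊤ := rfl

theorem coverShift_eq_coe {c b : ℤ} {x : WithTop ℤ} :
    coverShift c x = (b : WithTop ℤ) ↔ x = ((b - c : ℤ) : WithTop ℤ) := by
  have h : (b : WithTop ℤ) = coverShift c ((b - c : ℤ) : WithTop ℤ) := by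
    rw [coverShift_coe, sub_add_cancel]
  rw [h]
  exact (coverShift c).injective.eq_iff

theorem coverShift_eq_top {c : ℤ} {x : WithTop ℤ} : coverShift c x = ⊤ ↔ x = ⊤ :=
  (coverShift c).injective.eq_iff' (coverShift_top c)

theorem mem_lifts_smul {n : ℕ} (g : RotationGroup n) (c : ℤ) (hc : (c : ZMod n) = g.toAdd)
    (α : PuncturedArc n) (x y : WithTop ℤ) :
    (x, y) ∈ (g • α).lifts ↔ (coverShift c x, coverShift c y) ∈ α.lifts := by
  cases α with
  | spoke i =>
    simp only [PuncturedArc.smul_spoke, PuncturedArc.lifts, Set.mem_ofPred_eq, Prod.mk.injEq,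
      coverShift_eq_coe, coverShift_eq_top]
    constructor
    · rintro ⟨a, ha, rfl, rfl⟩
      exact ⟨a + c, by push_cast; rw [ha, hc]; ring, by simp, rfl⟩
    · rintro ⟨a, ha, rfl, rfl⟩
      exact ⟨a - c, by push_cast; rw [ha, hc], rfl, rfl⟩
  | chord i j h =>
    simp only [PuncturedArc.smul_chord, PuncturedArc.lifts, Set.mem_ofPred_eq, Prod.mk.injEq,
      coverShift_eq_coe]
    constructor
    · rintro ⟨a, b, ha, hb, hab, hn, rfl, rfl⟩
      exact ⟨a + c, b + c, by push_cast; rw [ha, hc]; ring, by push_cast; rw [hb, hc]; ring,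
        by omega, by omega, by simp, by simp⟩
    · rintro ⟨a, b, ha, hb, hab, hn, rfl, rfl⟩
      exact ⟨a - c, b - c, by push_cast; rw [ha, hc], by push_cast; rw [hb, hc],
        by omega, by omega, rfl, rfl⟩

theorem mem_liftedArcs_smul {n : ℕ} (g : RotationGroup n) (c : ℤ)
    (hc : (c : ZMod n) = g.toAdd) (T : Set (PuncturedArc n)) (x y : WithTop ℤ) :
    (x, y) ∈ liftedArcs (g • T) ↔ (coverShift c x, coverShift c y) ∈ liftedArcs T := by
  simp only [liftedArcs, Set.mem_iUnion, exists_prop]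
  constructor
  · rintro ⟨_, ⟨α, hα, rfl⟩, h⟩
    exact ⟨α, hα, (mem_lifts_smul g c hc α x y).1 h⟩
  · rintro ⟨α, hα, h⟩
    exact ⟨g • α, ⟨α, hα, rfl⟩, (mem_lifts_smul g c hc α x y).2 h⟩

theorem mem_liftedBoundary_shift (c : ℤ) (x y : WithTop ℤ) :
    (x, y) ∈ liftedBoundary ↔ (coverShift c x, coverShift c y) ∈ liftedBoundary := by
  simp only [liftedBoundary, Set.mem_ofPred_eq, Prod.mk.injEq, coverShift_eq_coe]
  constructor
  · rintro ⟨a, rfl, rfl⟩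
    exact ⟨a + c, by simp, by congr 1; ring⟩
  · rintro ⟨a, rfl, rfl⟩
    exact ⟨a - c, rfl, by congr 1; ring⟩

theorem isCell_shift {c : ℤ} {E E' : Set (WithTop ℤ × WithTop ℤ)}
    (hE : ∀ x y, (x, y) ∈ E' ↔ (coverShift c x, coverShift c y) ∈ E)
    {S : Finset (WithTop ℤ)} (hS : IsCell E S) :
    IsCell E' (S.map (coverShift c).symm.toEquiv.toEmbedding) := by
  intro x hx y hy hxy
  simp only [Finset.mem_map_equiv] at hx hy
  have h := hS _ hx _ hy ((coverShift c).lt_iff_lt.2 hxy)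
  rw [hE]
  refine h.trans (or_congr ?_ ?_)
  · constructor
    · intro H z hz hxz
      simp only [Finset.mem_map_equiv] at hz
      exact H _ hz ⟨(coverShift c).lt_iff_lt.2 hxz.1, (coverShift c).lt_iff_lt.2 hxz.2⟩
    · intro H z hz hxz
      refine H ((coverShift c).symm z) (by simpa using hz) ⟨?_, ?_⟩
      · exact (coverShift c).lt_symm_apply.2 hxz.1
      · exact (coverShift c).symm_apply_lt.2 hxz.2
  · constructor
    · intro H z hz
      simp only [Finset.mem_map_equiv] at hz
      exact ⟨(coverShift c).le_iff_le.1 (H _ hz).1, (coverShift c).le_iff_le.1 (H _ hz).2⟩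
    · intro H z hz
      have := H ((coverShift c).symm z) (by simpa using hz)
      exact ⟨(coverShift c).le_symm_apply.1 this.1, (coverShift c).symm_apply_le.1 this.2⟩

/-- Rotations map `(m+2)`-angulations to `(m+2)`-angulations. -/
theorem IsAngulation.smul {n m : ℕ} {T : Set (PuncturedArc n)} (hT : IsAngulation m T)
    (g : RotationGroup n) : IsAngulation m (g • T) := by
  obtain ⟨c, hc⟩ := ZMod.intCast_surjective g.toAdd
  have hA := mem_liftedArcs_smul g c hc T
  have hE : ∀ x y, (x, y) ∈ liftedArcs (g • T) ∪ liftedBoundary ↔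
      (coverShift c x, coverShift c y) ∈ liftedArcs T ∪ liftedBoundary := fun x y =>
    or_congr (hA x y) (mem_liftedBoundary_shift c x y)
  obtain ⟨h1, h2, h3⟩ := hT
  refine ⟨?_, ?_, ?_⟩
  · rintro _ ⟨α, hα, rfl⟩ _ ⟨β, hβ, rfl⟩ ⟨⟨x, y⟩, hx, ⟨z, w⟩, hz, h⟩
    refine h1 α hα β hβ ⟨_, (mem_lifts_smul g c hc α x y).1 hx, _,
      (mem_lifts_smul g c hc β z w).1 hz, ?_⟩
    simpa only [(coverShift c).lt_iff_lt] using h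
  · intro x y hxy
    obtain ⟨S, hS, hcard, hx, hy, H⟩ := h2 _ _ ((hA x y).1 hxy)
    refine ⟨_, isCell_shift hE hS, by simpa using hcard, by simpa [Finset.mem_map_equiv] using hx,
      by simpa [Finset.mem_map_equiv] using hy, ?_⟩
    intro z hz
    simp only [Finset.mem_map_equiv] at hz
    exact ⟨(coverShift c).le_iff_le.1 (H _ hz).1, (coverShift c).le_iff_le.1 (H _ hz).2⟩
  · intro x y hxy
    obtain ⟨S, hS, hcard, hx, hy, H⟩ := h3 _ _ ((hE x y).1 hxy)
    refine ⟨_, isCell_shift hE hS, by simpa using hcard, by simpa [Finset.mem_map_equiv] using hx,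
      by simpa [Finset.mem_map_equiv] using hy, ?_⟩
    intro z hz hxz
    simp only [Finset.mem_map_equiv] at hz
    exact H _ hz ⟨(coverShift c).lt_iff_lt.2 hxz.1, (coverShift c).lt_iff_lt.2 hxz.2⟩

theorem spokeCount_smul {n : ℕ} (g : RotationGroup n) (T : Set (PuncturedArc n)) :
    spokeCount (g • T) = spokeCount T := by
  have : {i : ZMod n | PuncturedArc.spoke i ∈ g • T} =
      (fun i => i - g.toAdd) '' {i : ZMod n | PuncturedArc.spoke i ∈ T} := by
    ext i
    simp only [Set.mem_ofPred_eq, Set.mem_image, Set.mem_smul_set_iff_inv_smul_mem,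
      PuncturedArc.smul_spoke, toAdd_inv, sub_neg_eq_add]
    constructor
    · intro h
      exact ⟨_, h, by ring⟩
    · rintro ⟨j, hj, rfl⟩
      simpa using hj
  rw [spokeCount, this, Set.ncard_image_of_injective _ (sub_left_injective)]
  rfl

/-- The action of the rotation group on the `(m+2)`-angulations with `s` spokes, restricted from
the action on sets of arcs. -/
instance {n m s : ℕ} : MulAction (RotationGroup n) (SpokeAngulation n m s) where
  smul g T := ⟨g • T.1, T.2.1.smul g, (spokeCount_smul g T.1).trans T.2.2⟩
  one_smul T := Subtype.ext (one_smul (RotationGroup n) T.1)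
  mul_smul g g' T := Subtype.ext (mul_smul g g' T.1)

/-! An angulation with at least one spoke is encoded, on the universal cover, by a function `h : ℤ →
ℤ` with `h (a + 1) = h a + 1 - m * k_a`, where `k_a` is the number of lifted arcs from `a` whose end
is finite and lies beyond `a + 1`. Peeling off cells shows that along every lifted edge `(a, b)`
with finite end the height changes by `1 - m * (number of edges from a beyond b)`, and that `h`
stays below `h b` strictly between `a` and `b`. So a cell with least vertex `p` and finite vertices
has its other vertices at `m + 1` consecutive levels, each reached for the first time after `p`; the
spokes sit at the records of `h` whose height is divisible by `m` (after normalizing `h` to vanish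
at one spoke).

Conversely, these rules define an angulation from any such `h` that gains `m * s` over a period
(`IsHeight.isAngulation`), and it has `s` spokes (`IsHeight.spokeCount_arcsOf`). The two
constructions are inverse to each other up to adding a multiple of `m` to `h`
(`IsCoverAngulation.exists_isHeight`, `IsHeight.sub_eq_of_heightEdges_eq`).

Counting is then easy. Over a period `n - m * ∑ k_a = m * s`, so the `k_a` are arbitrary naturals
with sum `n / m - s`, and `h 0` is free modulo `m`. This gives `m * multichoose n (n / m - s)`
(`card_normalizedHeight`). Rotations translate the argument of `h`. Hence an angulation of the `d *
N`-gon is fixed by the rotation by `N` exactly when `h` already has quasi-period `N`; this forces `d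
∣ s`, and the fixed angulations are counted by the same formula for `N` and `s / d` (`fixedByEquiv`,
`dvd_spokeCount_of_fixed`).

On the polynomial side, the Gaussian binomials `[dN - 1 + j choose dN - 1]` have generating function
`∏_{i < dN} (1 - q^i X)⁻¹` in `X`. At a primitive `d`-th root of unity this is `(1 - X^d)^(-N)`,
with coefficient `multichoose N (j / d)` if `d ∣ j` and `0` otherwise
(`IsPrimitiveRoot.aeval_qBinomial`). With `j = n / m - s` the two counts agree, unless `d ∣ j` while
`d ∤ s`; the congruence hypothesis excludes just this. -/

/-! ### Height functions -/

/-- A height function: it climbs by at most one at a time, all its values `h a - a` are congruent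
modulo `m`, and it gains `m * s` over a period `n`. -/
structure IsHeight (n m s : ℕ) (h : ℤ → ℤ) : Prop where
  step : ∀ a, ∃ k : ℕ, h (a + 1) = h a + 1 - m * k
  period : ∀ a, h (a + n) = h a + m * s

/-- The finite edges `(a, b)` of the angulation of the cover encoded by `h`. -/
def HeightEdge (m : ℕ) (h : ℤ → ℤ) (a b : ℤ) : Prop :=
  a < b ∧ (∀ c, a < c → c < b → h c < h b) ∧ h b ≤ h a + 1 ∧ (m : ℤ) ∣ h a + 1 - h b

/-- The height at `a` exceeds all earlier ones. -/
def IsRecord (h : ℤ → ℤ) (a : ℤ) : Prop := ∀ c, c < a → h c < h a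

/-- All edges, including boundary edges and spokes, of the angulation of the cover encoded
by `h`. -/
def heightEdges (m : ℕ) (h : ℤ → ℤ) : Set (WithTop ℤ × WithTop ℤ) :=
  {e | (∃ a b : ℤ, e = ((a : WithTop ℤ), (b : WithTop ℤ)) ∧ HeightEdge m h a b) ∨
    ∃ a : ℤ, e = ((a : WithTop ℤ), ⊤) ∧ IsRecord h a ∧ (m : ℤ) ∣ h a}

theorem coe_mem_heightEdges {m : ℕ} {h : ℤ → ℤ} {a b : ℤ} :
    ((a : WithTop ℤ), (b : WithTop ℤ)) ∈ heightEdges m h ↔ HeightEdge m h a b := by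
  constructor
  · rintro (⟨a', b', he, H⟩ | ⟨a', he, -⟩)
    · simp only [Prod.mk.injEq, WithTop.coe_inj] at he
      obtain ⟨rfl, rfl⟩ := he
      exact H
    · simp at he
  · exact fun H => Or.inl ⟨a, b, rfl, H⟩

theorem top_mem_heightEdges {m : ℕ} {h : ℤ → ℤ} {a : ℤ} :
    ((a : WithTop ℤ), (⊤ : WithTop ℤ)) ∈ heightEdges m h ↔ IsRecord h a ∧ (m : ℤ) ∣ h a := by
  constructor
  · rintro (⟨a', b', he, H⟩ | ⟨a', he, H⟩)
    · simp at he
    · simp only [Prod.mk.injEq, WithTop.coe_inj, and_true] at he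
      exact he ▸ H
  · exact fun H => Or.inr ⟨a, rfl, H⟩

theorem top_fst_notMem_heightEdges {m : ℕ} {h : ℤ → ℤ} {y : WithTop ℤ} :
    ((⊤ : WithTop ℤ), y) ∉ heightEdges m h := by
  rintro (⟨a', b', he, H⟩ | ⟨a', he, H⟩) <;> simp at he

namespace IsHeight

variable {n m s : ℕ} {h : ℤ → ℤ}

theorem le_succ (H : IsHeight n m s h) (a : ℤ) : h (a + 1) ≤ h a + 1 := by
  obtain ⟨k, hk⟩ := H.step a
  have : (0 : ℤ) ≤ m * k := by positivity
  omega

theorem dvd_succ (H : IsHeight n m s h) (a : ℤ) : (m : ℤ) ∣ h a + 1 - h (a + 1) := by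
  obtain ⟨k, hk⟩ := H.step a
  exact ⟨k, by omega⟩

theorem le_add (H : IsHeight n m s h) (a : ℤ) (i : ℕ) : h (a + i) ≤ h a + i := by
  induction i with
  | zero => simp
  | succ i ih =>
    have := H.le_succ (a + i)
    push_cast
    rw [← add_assoc]
    omega

theorem period_mul (H : IsHeight n m s h) (a k : ℤ) : h (a + n * k) = h a + m * s * k := by
  induction k using Int.induction_on with
  | zero => simp
  | succ i ih =>
    have := H.period (a + n * i)
    rw [show a + (n : ℤ) * (i + 1) = a + n * i + n by ring, this, ih]
    ring
  | pred i ih =>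
    have := H.period (a + n * (-i - 1))
    rw [show a + (n : ℤ) * (-i - 1) + n = a + n * (-i) by ring, ih] at this
    linear_combination -this

theorem heightEdge_succ (H : IsHeight n m s h) (a : ℤ) : HeightEdge m h a (a + 1) :=
  ⟨by omega, fun c _ _ => by omega, H.le_succ a, H.dvd_succ a⟩

/-- First passage at the level `L` from `p` on. -/
theorem exists_passage (hm : 0 < m) (hs : 0 < s) (H : IsHeight n m s h) {p L : ℤ}
    (hL : h p ≤ L) : ∃ q, p ≤ q ∧ h q = L ∧ ∀ c, p ≤ c → c < q → h c < L := by
  have hms : (0 : ℤ) < m * s := by positivity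
  obtain ⟨q, ⟨hq1, hq2⟩, hq3⟩ := Int.exists_least_of_bdd (P := fun q => p ≤ q ∧ L ≤ h q)
    -- Each period gains at least `1`, so `L - h p` periods suffice to reach the level `L`.
    ⟨p, fun z hz => hz.1⟩ ⟨p + n * (L - h p), by nlinarith, by
      rw [H.period_mul]; nlinarith⟩
  refine ⟨q, hq1, le_antisymm ?_ hq2, fun c hc hcq => ?_⟩
  · rcases eq_or_lt_of_le hq1 with rfl | hlt
    · exact hL
    · by_contra hcon
      -- The height climbs by at most one per step, so the level `L` cannot be jumped over.
      have h1 := H.le_succ (q - 1)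
      rw [sub_add_cancel] at h1
      have := hq3 (q - 1) ⟨by omega, by omega⟩
      omega
  · by_contra hcon
    have := hq3 c ⟨hc, by omega⟩
    omega

/-- First passage at level `L`, starting from minus infinity: by quasi-periodicity the heights are
unbounded above on the right and tend to minus infinity on the left, so there is a first position of
height at least `L`. -/
theorem exists_record (hn : 0 < n) (hm : 0 < m) (hs : 0 < s) (H : IsHeight n m s h) (L : ℤ) :
    ∃ q, h q = L ∧ IsRecord h q := by
  have hms : (0 : ℤ) < m * s := by positivity
  have hn' : (0 : ℤ) < n := by positivity
  -- Within one period the height exceeds `h 0` by less than `n`, so `m * s * (c / n)` must make up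
  -- at least `L - h 0 - n`.
  have hbd : ∀ c, h c ≥ L → n * (-|L - h 0 - n|) ≤ c := by
    intro c hc
    have e : c % n + n * (c / n) = c := Int.emod_add_mul_ediv c n
    have h0 := Int.emod_nonneg c hn'.ne'
    have h1 := Int.emod_lt_of_pos c hn'
    have h2 := H.period_mul (c % n) (c / n)
    have h3 := H.le_add 0 (c % n).toNat
    rw [e] at h2
    rw [Int.toNat_of_nonneg h0, zero_add] at h3
    have h4 : m * s * (c / n) ≥ L - h 0 - n := by linarith
    have h5 : c / n ≥ -|L - h 0 - n| := by
      by_contra hcon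
      push Not at hcon
      have h6 := neg_abs_le (L - h 0 - n)
      have h7 := abs_nonneg (L - h 0 - n)
      nlinarith
    nlinarith
  obtain ⟨q, hq2, hq3⟩ := Int.exists_least_of_bdd (P := fun q => L ≤ h q)
    ⟨_, hbd⟩ ⟨0 + n * |L - h 0|, by
      rw [H.period_mul]
      have h6 := le_abs_self (L - h 0)
      have h7 := abs_nonneg (L - h 0)
      nlinarith⟩
  have key : h q = L := by
    refine le_antisymm ?_ hq2
    by_contra hcon
    have h1 := H.le_succ (q - 1)
    rw [sub_add_cancel] at h1
    have := hq3 (q - 1) (by omega)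
    omega
  refine ⟨q, key, fun c hc => ?_⟩
  by_contra hcon
  have := hq3 c (by omega)
  omega

end IsHeight

/-! ### Cells as increasing sequences -/

/-- The first `k + 2` terms of `c` increase, and are joined by `E` when consecutive or extreme. -/
structure IsCellSeq (E : Set (WithTop ℤ × WithTop ℤ)) (k : ℕ) (c : ℕ → WithTop ℤ) : Prop where
  lt : ∀ i j, i < j → j ≤ k + 1 → c i < c j
  mem : ∀ i j, i < j → j ≤ k + 1 → ((c i, c j) ∈ E ↔ j = i + 1 ∨ (i = 0 ∧ j = k + 1))

namespace IsCellSeq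

variable {E : Set (WithTop ℤ × WithTop ℤ)} {k : ℕ} {c : ℕ → WithTop ℤ}

theorem lt_iff (hc : IsCellSeq E k c) {i j : ℕ} (hi : i ≤ k + 1) (hj : j ≤ k + 1) :
    c i < c j ↔ i < j := by
  refine ⟨fun h => ?_, fun h => hc.lt i j h hj⟩
  by_contra hcon
  rcases eq_or_lt_of_le (not_lt.1 hcon) with rfl | h'
  · exact lt_irrefl _ h
  · exact lt_asymm h (hc.lt j i h' hi)

theorem le_iff (hc : IsCellSeq E k c) {i j : ℕ} (hi : i ≤ k + 1) (hj : j ≤ k + 1) :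
    c i ≤ c j ↔ i ≤ j := by
  rw [← not_lt, hc.lt_iff hj hi, not_lt]

theorem exists_isCell (hc : IsCellSeq E k c) :
    ∃ S : Finset (WithTop ℤ), IsCell E S ∧ S.card = k + 2 ∧
      ∀ z, z ∈ S ↔ ∃ i, i ≤ k + 1 ∧ c i = z := by
  have hS : ∀ z, z ∈ (Finset.range (k + 2)).image c ↔ ∃ i, i ≤ k + 1 ∧ c i = z := by
    intro z
    simp only [Finset.mem_image, Finset.mem_range]
    exact ⟨fun ⟨i, h, h'⟩ => ⟨i, by omega, h'⟩, fun ⟨i, h, h'⟩ => ⟨i, by omega, h'⟩⟩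
  refine ⟨(Finset.range (k + 2)).image c, ?_, ?_, hS⟩
  · intro x hx y hy hxy
    obtain ⟨i, hi, rfl⟩ := (hS _).1 hx
    obtain ⟨j, hj, rfl⟩ := (hS _).1 hy
    rw [hc.lt_iff hi hj] at hxy
    rw [hc.mem i j hxy hj]
    refine or_congr ?_ ?_
    · constructor
      · rintro rfl z hz ⟨h1, h2⟩
        obtain ⟨l, hl, rfl⟩ := (hS _).1 hz
        rw [hc.lt_iff hi hl] at h1
        rw [hc.lt_iff hl hj] at h2
        omega
      · intro h
        by_contra hne
        refine h (c (i + 1)) ((hS _).2 ⟨i + 1, by omega, rfl⟩) ⟨?_, ?_⟩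
        · exact hc.lt _ _ (by omega) (by omega)
        · exact hc.lt _ _ (by omega) (by omega)
    · constructor
      · rintro ⟨rfl, rfl⟩ z hz
        obtain ⟨l, hl, rfl⟩ := (hS _).1 hz
        exact ⟨(hc.le_iff hi hl).2 (by omega), (hc.le_iff hl hj).2 (by omega)⟩
      · intro h
        have h1 := (h (c 0) ((hS _).2 ⟨0, by omega, rfl⟩)).1
        have h2 := (h (c (k + 1)) ((hS _).2 ⟨k + 1, by omega, rfl⟩)).2
        rw [hc.le_iff hi (by omega)] at h1
        rw [hc.le_iff (by omega) hj] at h2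
        omega
  · rw [Finset.card_image_of_injOn, Finset.card_range]
    intro i hi j hj hij
    simp only [Finset.coe_range, Set.mem_Iio] at hi hj
    have h1 := (hc.le_iff (i := i) (j := j) (by omega) (by omega)).1 hij.le
    have h2 := (hc.le_iff (i := j) (j := i) (by omega) (by omega)).1 hij.ge
    omega

end IsCellSeq

theorem IsCell.exists_isCellSeq {E : Set (WithTop ℤ × WithTop ℤ)} {S : Finset (WithTop ℤ)} {k : ℕ}
    (hS : IsCell E S) (hcard : S.card = k + 2) :
    ∃ c, IsCellSeq E k c ∧ ∀ z, z ∈ S ↔ ∃ i, i ≤ k + 1 ∧ c i = z := by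
  let f := S.orderEmbOfFin hcard
  let c : ℕ → WithTop ℤ := fun i => if hi : i < k + 2 then f ⟨i, hi⟩ else ⊤
  have hmem : ∀ z, z ∈ S ↔ ∃ i, i ≤ k + 1 ∧ c i = z := by
    intro z
    have : z ∈ S ↔ z ∈ Set.range f := by
      rw [Finset.range_orderEmbOfFin]; rfl
    rw [this]
    constructor
    · rintro ⟨⟨i, hi⟩, rfl⟩
      exact ⟨i, by omega, dif_pos hi⟩
    · rintro ⟨i, hi, rfl⟩
      exact ⟨⟨i, by omega⟩, by simp [c, show i < k + 2 by omega]⟩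
  have hlt : ∀ i j, i < j → j ≤ k + 1 → c i < c j := by
    intro i j hij hj
    simp only [c]
    rw [dif_pos (show i < k + 2 by omega), dif_pos (show j < k + 2 by omega)]
    exact f.strictMono (Fin.mk_lt_mk.2 hij)
  have hle : ∀ i j, i ≤ j → j ≤ k + 1 → c i ≤ c j := by
    intro i j hij hj
    rcases eq_or_lt_of_le hij with rfl | h
    · exact le_rfl
    · exact (hlt i j h hj).le
  refine ⟨c, ⟨hlt, fun i j hij hj => ?_⟩, hmem⟩
  rw [hS (c i) ((hmem _).2 ⟨i, by omega, rfl⟩) (c j) ((hmem _).2 ⟨j, hj, rfl⟩) (hlt i j hij hj)]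
  refine or_congr ?_ ?_
  · constructor
    · intro h
      by_contra hne
      exact h (c (i + 1)) ((hmem _).2 ⟨i + 1, by omega, rfl⟩)
        ⟨hlt _ _ (by omega) (by omega), hlt _ _ (by omega) (by omega)⟩
    · rintro rfl z hz ⟨h1, h2⟩
      obtain ⟨l, hl, rfl⟩ := (hmem _).1 hz
      rcases le_or_gt l i with h | h
      · exact absurd h1 (not_lt.2 (hle _ _ h (by omega)))
      · exact absurd h2 (not_lt.2 (hle _ _ h hl))
  · constructor
    · intro h
      have h1 := (h (c 0) ((hmem _).2 ⟨0, by omega, rfl⟩)).1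
      have h2 := (h (c (k + 1)) ((hmem _).2 ⟨k + 1, by omega, rfl⟩)).2
      constructor
      · by_contra hne
        exact absurd h1 (not_le.2 (hlt 0 i (by omega) (by omega)))
      · by_contra hne
        exact absurd h2 (not_le.2 (hlt j (k + 1) (by omega) (by omega)))
    · rintro ⟨rfl, rfl⟩ z hz
      obtain ⟨l, hl, rfl⟩ := (hmem _).1 hz
      exact ⟨hle _ _ (by omega) hl, hle _ _ hl le_rfl⟩

/-! ### The cells of a height function -/

namespace IsHeight

variable {n m s : ℕ} {h : ℤ → ℤ}

/-- The cell with least vertex `p` whose other vertices have heights from `L` to `L + m`. -/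
theorem exists_finite_cell (hm : 0 < m) (hs : 0 < s) (H : IsHeight n m s h) {p L : ℤ}
    (hL : h (p + 1) ≤ L) (hL' : L + m ≤ h p + 1) (hd : (m : ℤ) ∣ h p + 1 - L) :
    ∃ S, IsCell (heightEdges m h) S ∧ S.card = m + 2 ∧ ∀ z : WithTop ℤ, z ∈ S ↔ z = p ∨
      ∃ c : ℤ, z = c ∧ p < c ∧ (∀ y, p < y → y < c → h y < h c) ∧ L ≤ h c ∧ h c ≤ L + m := by
  -- The vertices after `p` are the first passages at `L, …, L + m`. An edge from `p` to the passage
  -- at `L + j` requires `m ∣ j`, so only the first and the last are joined to `p`; two passages are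
  -- joined only if their levels differ by one.
  have hρ : ∀ i : ℕ, ∃ q, p < q ∧ h q = L + i ∧ ∀ c, p < c → c < q → h c < L + i := by
    intro i
    obtain ⟨q, h1, h2, h3⟩ := H.exists_passage hm hs (p := p + 1) (L := L + i) (by omega)
    exact ⟨q, by omega, h2, fun c hc => h3 c (by omega)⟩
  choose ρ hρ1 hρ2 hρ3 using hρ
  have hmono : ∀ i j, i < j → ρ i < ρ j := by
    intro i j hij
    by_contra hcon
    rcases eq_or_lt_of_le (not_lt.1 hcon) with e | hlt
    · have h1 := hρ2 i
      have h2 := hρ2 j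
      rw [e, h1] at h2
      omega
    · have h1 := hρ3 i (ρ j) (hρ1 j) hlt
      have h2 := hρ2 j
      omega
  let c : ℕ → WithTop ℤ := fun i => Nat.casesOn i (p : WithTop ℤ) fun i => (ρ i : WithTop ℤ)
  have hseq : IsCellSeq (heightEdges m h) m c := by
    constructor
    · rintro (_ | i) (_ | j) hij hj
      · omega
      · exact WithTop.coe_lt_coe.2 (hρ1 j)
      · omega
      · exact WithTop.coe_lt_coe.2 (hmono i j (by omega))
    · rintro (_ | i) (_ | j) hij hj
      · omega
      · refine coe_mem_heightEdges.trans ⟨fun hE => ?_, fun hE => ⟨hρ1 j, ?_, ?_, ?_⟩⟩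
        · obtain ⟨k, hk⟩ := hE.2.2.2
          obtain ⟨k', hk'⟩ := hd
          rw [hρ2 j] at hk
          have : (m : ℤ) ∣ j := ⟨k' - k, by linear_combination hk' - hk⟩
          have : m ∣ j := by exact_mod_cast this
          rcases Nat.eq_zero_or_pos j with rfl | hj0
          · left; rfl
          · have := Nat.le_of_dvd hj0 this
            right; omega
        · rw [hρ2 j]; exact hρ3 j
        · rw [hρ2 j]; omega
        · rw [hρ2 j]
          rcases hE with hE | hE
          · have : j = 0 := by omega
            subst this
            simpa using hd
          · have : j = m := by omega
            subst this
            rw [← sub_sub]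
            exact dvd_sub hd dvd_rfl
      · omega
      · refine coe_mem_heightEdges.trans ⟨fun hE => ?_, fun hE => ⟨hmono i j (by omega), ?_, ?_, ?_⟩⟩
        · have := hE.2.2.1
          rw [hρ2, hρ2] at this
          left; omega
        · rw [hρ2 j]; exact fun c hc => hρ3 j c ((hρ1 i).trans hc)
        · rw [hρ2, hρ2]; omega
        · rw [hρ2, hρ2]
          have : j = i + 1 := by omega
          subst this
          push_cast
          ring_nf
          exact dvd_zero _
  obtain ⟨S, hS1, hS2, hS3⟩ := hseq.exists_isCell
  refine ⟨S, hS1, hS2, fun z => (hS3 z).trans ⟨?_, ?_⟩⟩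
  · rintro ⟨_ | i, hi, rfl⟩
    · exact Or.inl rfl
    · refine Or.inr ⟨ρ i, rfl, hρ1 i, ?_, ?_, ?_⟩
      · rw [hρ2]; exact hρ3 i
      · rw [hρ2]; omega
      · rw [hρ2]; omega
  · rintro (rfl | ⟨q, rfl, h1, h2, h3, h4⟩)
    · exact ⟨0, by omega, rfl⟩
    · refine ⟨(h q - L).toNat + 1, by omega, ?_⟩
      have e : L + ((h q - L).toNat : ℤ) = h q := by omega
      have e2 := hρ2 (h q - L).toNat
      have e3 := hρ3 (h q - L).toNat
      have : ρ (h q - L).toNat = q := by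
        rcases lt_trichotomy (ρ (h q - L).toNat) q with hlt | he | hlt
        · have := h2 _ (hρ1 _) hlt
          omega
        · exact he
        · have := e3 q h1 hlt
          omega
      exact congrArg _ this

/-- The cell at the puncture whose other vertices have heights from `L` to `L + m`. -/
theorem exists_top_cell (hn : 0 < n) (hm : 0 < m) (hs : 0 < s) (H : IsHeight n m s h) {L : ℤ}
    (hd : (m : ℤ) ∣ L) :
    ∃ S, IsCell (heightEdges m h) S ∧ S.card = m + 2 ∧ ∀ z : WithTop ℤ, z ∈ S ↔ z = ⊤ ∨
      ∃ c : ℤ, z = c ∧ IsRecord h c ∧ L ≤ h c ∧ h c ≤ L + m := by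
  -- Among the records at levels `L, …, L + m`, only the two extreme ones have height divisible by
  -- `m`, hence a spoke.
  choose ρ hρ2 hρ3 using fun i : ℕ => H.exists_record hn hm hs (L + i)
  have hmono : ∀ i j, i < j → ρ i < ρ j := by
    intro i j hij
    have h1 := hρ2 i
    have h2 := hρ2 j
    by_contra hcon
    rcases eq_or_lt_of_le (not_lt.1 hcon) with e | hlt
    · rw [e, h1] at h2
      omega
    · have h3 := hρ3 i (ρ j) hlt
      omega
  let c : ℕ → WithTop ℤ := fun i => if i = m + 1 then ⊤ else (ρ i : WithTop ℤ)
  have hc : ∀ i, i ≤ m → c i = ρ i := fun i hi => if_neg (by omega)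
  have hct : c (m + 1) = ⊤ := if_pos rfl
  have hseq : IsCellSeq (heightEdges m h) m c := by
    constructor
    · intro i j hij hj
      rw [hc i (by omega)]
      rcases eq_or_lt_of_le hj with rfl | hj'
      · rw [hct]; exact WithTop.coe_lt_top _
      · rw [hc j (by omega)]; exact WithTop.coe_lt_coe.2 (hmono i j hij)
    · intro i j hij hj
      rw [hc i (by omega)]
      rcases eq_or_lt_of_le hj with rfl | hj'
      · rw [hct, top_mem_heightEdges, hρ2, ← dvd_iff_dvd_of_dvd_sub (a := (m : ℤ)) (b := i)
          (c := L + i) (by simpa using hd)]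
        constructor
        · rintro ⟨-, h2⟩
          have : m ∣ i := by exact_mod_cast h2
          rcases Nat.eq_zero_or_pos i with rfl | hi0
          · right; simp
          · have := Nat.le_of_dvd hi0 this
            left; omega
        · rintro (h1 | h1)
          · have : i = m := by omega
            subst this
            exact ⟨hρ3 _, dvd_rfl⟩
          · rw [h1.1]; exact ⟨hρ3 _, by simp⟩
      · rw [hc j (by omega), coe_mem_heightEdges]
        refine ⟨fun hE => ?_, fun hE => ⟨hmono i j hij, fun c _ => hρ3 j c, ?_, ?_⟩⟩
        · have := hE.2.2.1
          rw [hρ2, hρ2] at this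
          left; omega
        · rw [hρ2, hρ2]; omega
        · rw [hρ2, hρ2]
          have : j = i + 1 := by omega
          subst this
          push_cast
          ring_nf
          exact dvd_zero _
  obtain ⟨S, hS1, hS2, hS3⟩ := hseq.exists_isCell
  refine ⟨S, hS1, hS2, fun z => (hS3 z).trans ⟨?_, ?_⟩⟩
  · rintro ⟨i, hi, rfl⟩
    rcases eq_or_lt_of_le hi with rfl | hi'
    · exact Or.inl hct
    · refine Or.inr ⟨ρ i, hc i (by omega), hρ3 i, ?_, ?_⟩ <;> rw [hρ2] <;> omega
  · rintro (rfl | ⟨q, rfl, h2, h3, h4⟩)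
    · exact ⟨m + 1, le_rfl, hct⟩
    · refine ⟨(h q - L).toNat, by omega, ?_⟩
      rw [hc _ (by omega)]
      have e2 := hρ2 (h q - L).toNat
      have e3 := hρ3 (h q - L).toNat
      have : ρ (h q - L).toNat = q := by
        rcases lt_trichotomy (ρ (h q - L).toNat) q with hlt | he | hlt
        · have := h2 _ hlt
          omega
        · exact he
        · have := e3 q hlt
          omega
      exact congrArg _ this

end IsHeight

/-! ### Sets of arcs and sets of edges of the cover -/

/-- The lifts of the arcs of `T` and of the boundary edges. -/
def coverEdges {n : ℕ} (T : Set (PuncturedArc n)) : Set (WithTop ℤ × WithTop ℤ) :=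
  liftedArcs T ∪ liftedBoundary

/-- The arcs whose lifts belong to `E`. -/
def arcsOf (n : ℕ) (E : Set (WithTop ℤ × WithTop ℤ)) : Set (PuncturedArc n) := {α | α.lifts ⊆ E}

namespace PuncturedArc

variable {n : ℕ}

theorem coe_mem_lifts_spoke {i : ZMod n} {a b : ℤ} :
    ((a : WithTop ℤ), (b : WithTop ℤ)) ∉ (spoke i).lifts := by
  rintro ⟨c, -, he⟩
  simp at he

theorem top_mem_lifts_spoke {i : ZMod n} {a : ℤ} :
    ((a : WithTop ℤ), (⊤ : WithTop ℤ)) ∈ (spoke i).lifts ↔ (a : ZMod n) = i := by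
  constructor
  · rintro ⟨c, hc, he⟩
    simp only [Prod.mk.injEq, WithTop.coe_inj, and_true] at he
    exact he ▸ hc
  · exact fun h => ⟨a, h, rfl⟩

theorem top_mem_lifts_chord {i j : ZMod n} {h : j ≠ i + 1} {x : WithTop ℤ} :
    (x, (⊤ : WithTop ℤ)) ∉ (chord i j h).lifts := by
  rintro ⟨c, d, -, -, -, -, he⟩
  simp at he

theorem coe_mem_lifts_chord {i j : ZMod n} {h : j ≠ i + 1} {a b : ℤ} :
    ((a : WithTop ℤ), (b : WithTop ℤ)) ∈ (chord i j h).lifts ↔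
      (a : ZMod n) = i ∧ (b : ZMod n) = j ∧ a < b ∧ b ≤ a + n := by
  constructor
  · rintro ⟨c, d, h1, h2, h3, h4, he⟩
    simp only [Prod.mk.injEq, WithTop.coe_inj] at he
    obtain ⟨rfl, rfl⟩ := he
    exact ⟨h1, h2, h3, h4⟩
  · rintro ⟨h1, h2, h3, h4⟩
    exact ⟨a, b, h1, h2, h3, h4, rfl⟩

/-- Every lift is a spoke or a chord of the cover. -/
theorem exists_eq_of_mem_lifts {α : PuncturedArc n} {x y : WithTop ℤ} (h : (x, y) ∈ α.lifts) :
    ∃ a : ℤ, x = a ∧ (y = ⊤ ∨ ∃ b : ℤ, y = b ∧ a + 1 < b ∧ b ≤ a + n) := by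
  cases α with
  | spoke i =>
    obtain ⟨a, -, he⟩ := h
    rw [Prod.mk.injEq] at he
    exact ⟨a, he.1, Or.inl he.2⟩
  | chord i j hij =>
    obtain ⟨a, b, ha, hb, h1, h2, he⟩ := h
    rw [Prod.mk.injEq] at he
    refine ⟨a, he.1, Or.inr ⟨b, he.2, lt_of_le_of_ne h1 ?_, h2⟩⟩
    rintro rfl
    apply hij
    rw [← ha, ← hb]
    push_cast
    rfl

theorem eq_of_mem_lifts {α β : PuncturedArc n} {e : WithTop ℤ × WithTop ℤ} (hα : e ∈ α.lifts)
    (hβ : e ∈ β.lifts) : α = β := by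
  obtain ⟨x, y⟩ := e
  obtain ⟨a, rfl, rfl | ⟨b, rfl, -⟩⟩ := exists_eq_of_mem_lifts hα
  · cases α with
    | spoke i =>
      cases β with
      | spoke j => rw [top_mem_lifts_spoke] at hα hβ; rw [← hα, ← hβ]
      | chord k l h => exact absurd hβ top_mem_lifts_chord
    | chord k l h => exact absurd hα top_mem_lifts_chord
  · cases α with
    | spoke i => exact absurd hα coe_mem_lifts_spoke
    | chord i j h =>
      cases β with
      | spoke j => exact absurd hβ coe_mem_lifts_spoke
      | chord k l h =>
        rw [coe_mem_lifts_chord] at hα hβ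
        obtain ⟨rfl, rfl, -⟩ := hα
        obtain ⟨rfl, rfl, -⟩ := hβ
        rfl

theorem lifts_nonempty (hn : 0 < n) (α : PuncturedArc n) : α.lifts.Nonempty := by
  have hn' : (0 : ℤ) < n := by exact_mod_cast hn
  cases α with
  | spoke i =>
    obtain ⟨a, ha⟩ := ZMod.intCast_surjective i
    exact ⟨_, a, ha, rfl⟩
  | chord i j h =>
    obtain ⟨a, ha⟩ := ZMod.intCast_surjective i
    obtain ⟨b, hb⟩ := ZMod.intCast_surjective (j - i - 1)
    have h0 := Int.emod_nonneg b hn'.ne'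
    have h1 := Int.emod_lt_of_pos b hn'
    -- Reducing `j - i - 1` rather than `j - i` puts the end in `(a, a + n]`, so that a loop gets
    -- length `n` and not `0`.
    refine ⟨_, a, a + 1 + b % n, ha, ?_, by omega, by omega, rfl⟩
    push_cast
    rw [ha, hb]
    ring

/-- The lifts of an arc are translates of each other. -/
theorem exists_shift_of_mem_lifts (hn : 0 < n) {α : PuncturedArc n} {x y x' y' : WithTop ℤ}
    (h : (x, y) ∈ α.lifts) (h' : (x', y') ∈ α.lifts) :
    ∃ k : ℤ, x' = coverShift (n * k) x ∧ y' = coverShift (n * k) y := by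
  cases α with
  | spoke i =>
    obtain ⟨a, rfl, he⟩ := h
    obtain ⟨a', ha, he'⟩ := h'
    rw [Prod.mk.injEq] at he he'
    obtain ⟨rfl, rfl⟩ := he
    obtain ⟨rfl, rfl⟩ := he'
    obtain ⟨k, hk⟩ := (ZMod.intCast_eq_intCast_iff_dvd_sub _ _ _).1 ha.symm
    exact ⟨k, by rw [coverShift_coe]; congr 1; omega, rfl⟩
  | chord i j hij =>
    obtain ⟨a, b, rfl, rfl, h1, h2, he⟩ := h
    obtain ⟨a', b', ha, hb, h1', h2', he'⟩ := h'
    rw [Prod.mk.injEq] at he he'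
    obtain ⟨rfl, rfl⟩ := he
    obtain ⟨rfl, rfl⟩ := he'
    obtain ⟨k, hk⟩ := (ZMod.intCast_eq_intCast_iff_dvd_sub _ _ _).1 ha.symm
    obtain ⟨l, hl⟩ := (ZMod.intCast_eq_intCast_iff_dvd_sub _ _ _).1 hb.symm
    have hn' : (0 : ℤ) < n := by exact_mod_cast hn
    -- Both lifts have length in `(0, n]`, so their lengths, being congruent modulo `n`, are equal.
    have : k = l := by
      have e : (n : ℤ) * (l - k) = (b' - a') - (b - a) := by linear_combination hk - hl
      have h3 : l - k < 1 := by
        by_contra hcon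
        nlinarith
      have h4 : -1 < l - k := by
        by_contra hcon
        nlinarith
      omega
    subst this
    exact ⟨k, by rw [coverShift_coe]; congr 1; omega, by rw [coverShift_coe]; congr 1; omega⟩

end PuncturedArc

theorem coe_succ_mem_liftedBoundary (a : ℤ) :
    ((a : WithTop ℤ), ((a + 1 : ℤ) : WithTop ℤ)) ∈ liftedBoundary := ⟨a, rfl⟩

theorem notMem_liftedBoundary_of_mem_lifts {n : ℕ} {α : PuncturedArc n}
    {e : WithTop ℤ × WithTop ℤ} (h : e ∈ α.lifts) : e ∉ liftedBoundary := by
  rintro ⟨c, rfl⟩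
  obtain ⟨a, ha, hb | ⟨b, hb, h1, -⟩⟩ := PuncturedArc.exists_eq_of_mem_lifts h
  · simp at hb
  · rw [WithTop.coe_inj] at ha hb
    omega

theorem mem_liftedArcs {n : ℕ} {T : Set (PuncturedArc n)} {e : WithTop ℤ × WithTop ℤ} :
    e ∈ liftedArcs T ↔ ∃ α ∈ T, e ∈ α.lifts := by
  simp [liftedArcs]

/-- Any single lift determines its arc, and no lift of an arc is a boundary edge; so `T` can be read
off from its edges in the cover. -/
theorem arcsOf_coverEdges {n : ℕ} (hn : 0 < n) (T : Set (PuncturedArc n)) :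
    arcsOf n (coverEdges T) = T := by
  ext α
  constructor
  · intro h
    obtain ⟨e, he⟩ := α.lifts_nonempty hn
    rcases h he with h' | h'
    · obtain ⟨β, hβ, he'⟩ := mem_liftedArcs.1 h'
      rw [PuncturedArc.eq_of_mem_lifts he he']
      exact hβ
    · exact absurd h' (notMem_liftedBoundary_of_mem_lifts he)
  · exact fun hα e he => Or.inl (mem_liftedArcs.2 ⟨α, hα, he⟩)

theorem coverEdges_injective {n : ℕ} (hn : 0 < n) :
    Function.Injective (coverEdges (n := n)) :=
  Function.LeftInverse.injective (arcsOf_coverEdges hn)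

/-! ### The angulation of a height function -/

namespace IsHeight

variable {n m s : ℕ} {h : ℤ → ℤ}

/-- An edge passing over `a + n` would need `h (a + n) < h b ≤ h a + 1`, but a period gains at least
`1`. Hence every edge of the height function is short enough to be the lift of a chord. -/
theorem heightEdge_le (hm : 0 < m) (hs : 0 < s) (H : IsHeight n m s h) {a b : ℤ}
    (hE : HeightEdge m h a b) (hn : 0 < n) : b ≤ a + n := by
  by_contra hcon
  have h1 := hE.2.1 (a + n) (by omega) (by omega)
  have h2 := H.period a
  have h3 := hE.2.2.1
  have : (0 : ℤ) < m * s := by positivity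
  omega

theorem heightEdge_shift (H : IsHeight n m s h) {a b : ℤ} (k : ℤ) (hE : HeightEdge m h a b) :
    HeightEdge m h (a + n * k) (b + n * k) := by
  obtain ⟨h1, h2, h3, h4⟩ := hE
  refine ⟨by omega, fun c hc hc' => ?_, ?_, ?_⟩
  · have := h2 (c - n * k) (by omega) (by omega)
    have e := H.period_mul (c - n * k) k
    rw [sub_add_cancel] at e
    rw [H.period_mul, e]
    omega
  · rw [H.period_mul, H.period_mul]; omega
  · rw [H.period_mul, H.period_mul]
    convert h4 using 1
    ring

theorem isRecord_shift (H : IsHeight n m s h) {a : ℤ} (k : ℤ) (hE : IsRecord h a) :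
    IsRecord h (a + n * k) := by
  intro c hc
  have := hE (c - n * k) (by omega)
  have e := H.period_mul (c - n * k) k
  rw [sub_add_cancel] at e
  rw [H.period_mul, e]
  omega

theorem heightEdges_shift (H : IsHeight n m s h) {x y : WithTop ℤ} (k : ℤ)
    (hE : (x, y) ∈ heightEdges m h) :
    (coverShift (n * k) x, coverShift (n * k) y) ∈ heightEdges m h := by
  rcases hE with ⟨a, b, he, hE⟩ | ⟨a, he, hE, hd⟩
  · rw [Prod.mk.injEq] at he
    obtain ⟨rfl, rfl⟩ := he
    exact coe_mem_heightEdges.2 (H.heightEdge_shift k hE)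
  · rw [Prod.mk.injEq] at he
    obtain ⟨rfl, rfl⟩ := he
    refine top_mem_heightEdges.2 ⟨H.isRecord_shift k hE, ?_⟩
    change (m : ℤ) ∣ h (a + n * k)
    rw [H.period_mul, mul_assoc]
    exact dvd_add hd (dvd_mul_right _ _)

theorem mem_liftedArcs_arcsOf (hn : 0 < n) (hm : 0 < m) (hs : 0 < s) (H : IsHeight n m s h)
    {x y : WithTop ℤ} : (x, y) ∈ liftedArcs (arcsOf n (heightEdges m h)) ↔
      (x, y) ∈ heightEdges m h ∧ (x, y) ∉ liftedBoundary := by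
  rw [mem_liftedArcs]
  constructor
  · rintro ⟨α, hα, he⟩
    exact ⟨hα he, notMem_liftedBoundary_of_mem_lifts he⟩
  · rintro ⟨hE, hB⟩
    -- One lift is enough: the other lifts are translates by multiples of `n`, and the edges of `h`
    -- are invariant under these.
    suffices ∃ α : PuncturedArc n, (x, y) ∈ α.lifts by
      obtain ⟨α, hα⟩ := this
      refine ⟨α, ?_, hα⟩
      rintro ⟨x', y'⟩ he'
      obtain ⟨k, rfl, rfl⟩ := PuncturedArc.exists_shift_of_mem_lifts hn hα he'
      exact H.heightEdges_shift k hE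
    rcases hE with ⟨a, b, he, hE⟩ | ⟨a, he, hE, hd⟩
    · rw [Prod.mk.injEq] at he
      obtain ⟨rfl, rfl⟩ := he
      have hle := H.heightEdge_le hm hs hE hn
      have hlt := hE.1
      refine ⟨.chord a b fun hab => hB ?_, PuncturedArc.coe_mem_lifts_chord.2 ⟨rfl, rfl, hlt, hle⟩⟩
      have hab' : ((a + 1 : ℤ) : ZMod n) = (b : ℤ) := by rw [hab]; push_cast; rfl
      obtain ⟨k, hk⟩ := (ZMod.intCast_eq_intCast_iff_dvd_sub _ _ _).1 hab'
      have : k = 0 := by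
        have h3 : k < 1 := by
          by_contra hcon
          nlinarith
        have h4 : -1 < k := by
          by_contra hcon
          nlinarith
        omega
      rw [this] at hk
      obtain rfl : b = a + 1 := by omega
      exact coe_succ_mem_liftedBoundary a
    · rw [Prod.mk.injEq] at he
      obtain ⟨rfl, rfl⟩ := he
      exact ⟨.spoke a, PuncturedArc.top_mem_lifts_spoke.2 rfl⟩

theorem coverEdges_arcsOf (hn : 0 < n) (hm : 0 < m) (hs : 0 < s) (H : IsHeight n m s h) :
    coverEdges (arcsOf n (heightEdges m h)) = heightEdges m h := by
  ext ⟨x, y⟩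
  rw [coverEdges, Set.mem_union, H.mem_liftedArcs_arcsOf hn hm hs]
  constructor
  · rintro (h | ⟨a, ha⟩)
    · exact h.1
    · rw [ha]
      exact coe_mem_heightEdges.2 (H.heightEdge_succ a)
  · intro h
    by_cases hB : (x, y) ∈ liftedBoundary
    · exact Or.inr hB
    · exact Or.inl ⟨h, hB⟩

end IsHeight

/-- If `a < c < b < d` with edges `(a, b)` and `(c, d)`, then `h c < h b < h d ≤ h c + 1`, which is
absurd for integers. If the second edge is a spoke at `c`, then `h a < h c < h b ≤ h a + 1`. -/
theorem not_crossing_heightEdges {m : ℕ} {h : ℤ → ℤ} {x y z w : WithTop ℤ}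
    (h1 : (x, y) ∈ heightEdges m h) (h2 : (z, w) ∈ heightEdges m h) :
    ¬ (x < z ∧ z < y ∧ y < w) := by
  rintro ⟨hxz, hzy, hyw⟩
  rcases h1 with ⟨a, b, he, hE⟩ | ⟨a, he, hE, -⟩
  · rw [Prod.mk.injEq] at he
    obtain ⟨rfl, rfl⟩ := he
    rcases h2 with ⟨c, d, he, hE'⟩ | ⟨c, he, hE', -⟩
    · rw [Prod.mk.injEq] at he
      obtain ⟨rfl, rfl⟩ := he
      rw [WithTop.coe_lt_coe] at hxz hzy hyw
      have h1 := hE.2.1 c hxz hzy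
      have h2 := hE'.2.1 b hzy hyw
      have h3 := hE'.2.2.1
      omega
    · rw [Prod.mk.injEq] at he
      obtain ⟨rfl, rfl⟩ := he
      rw [WithTop.coe_lt_coe] at hxz hzy
      have h1 := hE.2.1 c hxz hzy
      have h2 := hE' a hxz
      have h3 := hE.2.2.1
      omega
  · rw [Prod.mk.injEq] at he
    obtain ⟨rfl, rfl⟩ := he
    exact not_top_lt hyw

/-! ### The cells on both sides of an edge, and the number of spokes -/

namespace IsHeight

variable {n m s : ℕ} {h : ℤ → ℤ}

/-- For a finite edge `(a, b)` the cell has least vertex `a` and top level `h b`; for a spoke at `a`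
it is the cell at the puncture with bottom level `h a`. -/
theorem exists_cell_below (hn : 0 < n) (hm : 0 < m) (hs : 0 < s) (H : IsHeight n m s h)
    {x y : WithTop ℤ} (hE : (x, y) ∈ heightEdges m h) (hB : (x, y) ∉ liftedBoundary) :
    ∃ S : Finset (WithTop ℤ), IsCell (heightEdges m h) S ∧ S.card = m + 2 ∧
      x ∈ S ∧ y ∈ S ∧ ∀ z ∈ S, x ≤ z ∧ z ≤ y := by
  rcases hE with ⟨a, b, he, hE⟩ | ⟨a, he, hE, hd⟩
  · rw [Prod.mk.injEq] at he
    obtain ⟨rfl, rfl⟩ := he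
    obtain ⟨h1, h2, h3, h4⟩ := hE
    have hlt : a + 1 < b := by
      refine lt_of_le_of_ne h1 ?_
      rintro rfl
      exact hB (coe_succ_mem_liftedBoundary a)
    have h5 := h2 (a + 1) (by omega) hlt
    -- `h (a + 1)` lies strictly below `h b` and is congruent to it modulo `m`; this makes `h b - m`
    -- an admissible bottom level.
    have h6 : h (a + 1) + m ≤ h b := by
      have h7 := H.dvd_succ a
      have h8 : (m : ℤ) ∣ h b - h (a + 1) := by
        obtain ⟨k, hk⟩ := h7
        obtain ⟨l, hl⟩ := h4
        exact ⟨k - l, by linear_combination hk - hl⟩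
      have := Int.le_of_dvd (by omega) h8
      omega
    obtain ⟨S, hS1, hS2, hS3⟩ := H.exists_finite_cell (p := a) (L := h b - m) hm hs (by omega)
      (by omega) (by
        obtain ⟨k, hk⟩ := h4
        exact ⟨k + 1, by linear_combination hk⟩)
    refine ⟨S, hS1, hS2, (hS3 _).2 (Or.inl rfl), (hS3 _).2 (Or.inr ⟨b, rfl, h1, h2, ?_, ?_⟩), ?_⟩
    · omega
    · omega
    · intro z hz
      rcases (hS3 z).1 hz with rfl | ⟨c, rfl, hc1, hc2, hc3, hc4⟩
      · exact ⟨le_rfl, WithTop.coe_le_coe.2 h1.le⟩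
      · refine ⟨WithTop.coe_le_coe.2 hc1.le, WithTop.coe_le_coe.2 ?_⟩
        by_contra hcon
        have := hc2 b h1 (by omega)
        omega
  · rw [Prod.mk.injEq] at he
    obtain ⟨rfl, rfl⟩ := he
    obtain ⟨S, hS1, hS2, hS3⟩ := H.exists_top_cell hn hm hs hd
    refine ⟨S, hS1, hS2, (hS3 _).2 (Or.inr ⟨a, rfl, hE, le_rfl, by omega⟩),
      (hS3 _).2 (Or.inl rfl), ?_⟩
    intro z hz
    rcases (hS3 z).1 hz with rfl | ⟨c, rfl, hc1, hc2, hc3⟩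
    · exact ⟨le_top, le_rfl⟩
    · refine ⟨WithTop.coe_le_coe.2 ?_, le_top⟩
      by_contra hcon
      have := hE c (by omega)
      omega

/-- The cell beyond an edge which is outermost among the edges from `a`, when `a` is not a record. -/
theorem exists_cell_above_of_not_isRecord (hm : 0 < m) (hs : 0 < s)
    (H : IsHeight n m s h) {a b : ℤ} (hE : HeightEdge m h a b) (hab : h b = h a + 1)
    (hr : ¬ IsRecord h a) :
    ∃ S : Finset (WithTop ℤ), IsCell (heightEdges m h) S ∧ S.card = m + 2 ∧
      (a : WithTop ℤ) ∈ S ∧ (b : WithTop ℤ) ∈ S ∧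
      ∀ z ∈ S, ¬ ((a : WithTop ℤ) < z ∧ z < (b : WithTop ℤ)) := by
  obtain ⟨h1, h2, h3, h4⟩ := hE
  simp only [IsRecord, not_forall] at hr
  obtain ⟨p0, hp0, hp0'⟩ := hr
  -- The least vertex of the cell is the last position before `a` that is at least as high as `a`:
  -- seen from there, `a` is a new maximum, and so is `b`.
  obtain ⟨p, ⟨hp1, hp2⟩, hp3⟩ := Int.exists_greatest_of_bdd (P := fun p => p < a ∧ h a ≤ h p)
    ⟨a, fun z hz => hz.1.le⟩ ⟨p0, hp0, by omega⟩
  have hp4 : ∀ c, p < c → c < a → h c < h a := by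
    intro c hc hca
    by_contra hcon
    have := hp3 c ⟨hca, by omega⟩
    omega
  have hm' : (0 : ℤ) < m := by exact_mod_cast hm
  -- the top level of the cell is the least admissible level above `h a`
  set L := h p + 1 - m * ((h p - h a) / m) - m with hL
  have e := Int.emod_add_mul_ediv (h p - h a) m
  have e0 := Int.emod_nonneg (h p - h a) hm'.ne'
  have e1 := Int.emod_lt_of_pos (h p - h a) hm'
  have e2 : (0 : ℤ) ≤ m * ((h p - h a) / m) := by
    have := Int.ediv_nonneg (show 0 ≤ h p - h a by omega) hm'.le
    positivity
  have hLd : (m : ℤ) ∣ h p + 1 - L := ⟨(h p - h a) / m + 1, by rw [hL]; ring⟩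
  have hLp : h (p + 1) ≤ L := by
    have h6 : h (p + 1) ≤ h a := by
      rcases eq_or_lt_of_le (show p + 1 ≤ a by omega) with he | hlt
      · rw [he]
      · exact (hp4 (p + 1) (by omega) hlt).le
    obtain ⟨i, hi⟩ := H.dvd_succ p
    obtain ⟨j, hj⟩ := hLd
    have hij : L - h (p + 1) = m * (i - j) := by linear_combination hi - hj
    have : 0 ≤ i - j := by
      by_contra hcon
      nlinarith
    nlinarith
  obtain ⟨S, hS1, hS2, hS3⟩ := H.exists_finite_cell (p := p) (L := L) hm hs hLp (by omega) hLd
  refine ⟨S, hS1, hS2, (hS3 _).2 (Or.inr ⟨a, rfl, hp1, hp4, by omega, by omega⟩),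
    (hS3 _).2 (Or.inr ⟨b, rfl, by omega, ?_, by omega, by omega⟩), ?_⟩
  · intro y hy hyb
    rcases lt_trichotomy y a with hlt | rfl | hlt
    · have := hp4 y hy hlt
      omega
    · omega
    · exact h2 y hlt hyb
  · rintro z hz ⟨hz1, hz2⟩
    rcases (hS3 z).1 hz with rfl | ⟨c, rfl, hc1, hc2, hc3, hc4⟩
    · rw [WithTop.coe_lt_coe] at hz1
      omega
    · rw [WithTop.coe_lt_coe] at hz1 hz2
      have g1 := hc2 a hp1 hz1
      have g2 := h2 c hz1 hz2
      omega

/-- If `h b < h a + 1`, a further edge from `a` lies beyond `b`, and the cell has least vertex `a`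
and bottom level `h b`. If `h b = h a + 1`, then `a` and `b` are at neighbouring levels of a cell
that is at the puncture when `a` is a record and otherwise has its least vertex before `a`. For a
spoke at `a` the levels run from `h a - m` to `h a`. -/
theorem exists_cell_above (hn : 0 < n) (hm : 0 < m) (hs : 0 < s) (H : IsHeight n m s h)
    {x y : WithTop ℤ} (hE : (x, y) ∈ heightEdges m h) :
    ∃ S : Finset (WithTop ℤ), IsCell (heightEdges m h) S ∧ S.card = m + 2 ∧
      x ∈ S ∧ y ∈ S ∧ ∀ z ∈ S, ¬ (x < z ∧ z < y) := by
  have hm' : (0 : ℤ) < m := by exact_mod_cast hm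
  rcases hE with ⟨a, b, he, hE⟩ | ⟨a, he, hE, hd⟩
  · rw [Prod.mk.injEq] at he
    obtain ⟨rfl, rfl⟩ := he
    have hE0 := hE
    obtain ⟨h1, h2, h3, h4⟩ := hE
    rcases eq_or_lt_of_le h3 with h5 | h5
    · by_cases hr : IsRecord h a
      · obtain ⟨S, hS1, hS2, hS3⟩ := H.exists_top_cell (L := m * (h a / m)) hn hm hs
          (dvd_mul_right _ _)
        have e := Int.emod_add_mul_ediv (h a) m
        have e0 := Int.emod_nonneg (h a) hm'.ne'
        have e1 := Int.emod_lt_of_pos (h a) hm'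
        refine ⟨S, hS1, hS2, (hS3 _).2 (Or.inr ⟨a, rfl, hr, by omega, by omega⟩),
          (hS3 _).2 (Or.inr ⟨b, rfl, fun y hy => ?_, by omega, by omega⟩), ?_⟩
        · rcases lt_trichotomy y a with hlt | rfl | hlt
          · have := hr y hlt
            omega
          · omega
          · exact h2 y hlt hy
        · rintro z hz ⟨hz1, hz2⟩
          rcases (hS3 z).1 hz with rfl | ⟨c, rfl, hc1, hc2, hc3⟩
          · exact not_top_lt hz2
          · rw [WithTop.coe_lt_coe] at hz1 hz2
            have g1 := hc1 a hz1
            have g2 := h2 c hz1 hz2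
            omega
      · exact H.exists_cell_above_of_not_isRecord hm hs hE0 h5 hr
    · have h6 : h b + m ≤ h a + 1 := by
        have := Int.le_of_dvd (by omega) h4
        omega
      have h7 : h (a + 1) ≤ h b := by
        rcases eq_or_lt_of_le (show a + 1 ≤ b by omega) with he | hlt
        · rw [he]
        · exact (h2 _ (by omega) hlt).le
      obtain ⟨S, hS1, hS2, hS3⟩ := H.exists_finite_cell (p := a) (L := h b) hm hs h7 h6 h4
      refine ⟨S, hS1, hS2, (hS3 _).2 (Or.inl rfl),
        (hS3 _).2 (Or.inr ⟨b, rfl, h1, h2, le_rfl, by omega⟩), ?_⟩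
      rintro z hz ⟨hz1, hz2⟩
      rcases (hS3 z).1 hz with rfl | ⟨c, rfl, hc1, hc2, hc3, hc4⟩
      · exact lt_irrefl _ hz1
      · rw [WithTop.coe_lt_coe] at hz1 hz2
        have g2 := h2 c hz1 hz2
        omega
  · rw [Prod.mk.injEq] at he
    obtain ⟨rfl, rfl⟩ := he
    obtain ⟨S, hS1, hS2, hS3⟩ := H.exists_top_cell (L := h a - m) hn hm hs (dvd_sub hd dvd_rfl)
    refine ⟨S, hS1, hS2, (hS3 _).2 (Or.inr ⟨a, rfl, hE, by omega, by omega⟩),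
      (hS3 _).2 (Or.inl rfl), ?_⟩
    rintro z hz ⟨hz1, hz2⟩
    rcases (hS3 z).1 hz with rfl | ⟨c, rfl, hc1, hc2, hc3⟩
    · exact lt_irrefl _ hz2
    · rw [WithTop.coe_lt_coe] at hz1
      have := hc1 a hz1
      omega

theorem isAngulation (hn : 0 < n) (hm : 0 < m) (hs : 0 < s) (H : IsHeight n m s h) :
    IsAngulation m (arcsOf n (heightEdges m h)) := by
  have hC := H.coverEdges_arcsOf hn hm hs
  rw [coverEdges] at hC
  refine ⟨?_, ?_, ?_⟩
  · rintro α hα β hβ ⟨e, he, f, hf, h | h⟩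
    · exact not_crossing_heightEdges (hα he) (hβ hf) h
    · exact not_crossing_heightEdges (hβ hf) (hα he) h
  · intro x y hxy
    rw [H.mem_liftedArcs_arcsOf hn hm hs] at hxy
    rw [hC]
    exact H.exists_cell_below hn hm hs hxy.1 hxy.2
  · intro x y hxy
    rw [hC] at hxy ⊢
    exact H.exists_cell_above hn hm hs hxy

theorem spoke_mem_arcsOf (H : IsHeight n m s h) (a : ℤ) :
    PuncturedArc.spoke (a : ZMod n) ∈ arcsOf n (heightEdges m h) ↔
      IsRecord h a ∧ (m : ℤ) ∣ h a := by
  constructor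
  · intro hα
    exact top_mem_heightEdges.1 (hα ⟨a, rfl, rfl⟩)
  · rintro hE e ⟨b, hb, rfl⟩
    obtain ⟨k, hk⟩ := (ZMod.intCast_eq_intCast_iff_dvd_sub _ _ _).1 hb.symm
    have := H.heightEdges_shift k (top_mem_heightEdges.2 hE)
    rw [coverShift_coe, coverShift_top] at this
    convert this using 3
    omega

/-- There is exactly one record `ρ j` at each level `m * j`, and translation by `n` takes level `m *
j` to level `m * (j + s)`. So the spokes correspond to the residues of `j` modulo `s`. -/
theorem spokeCount_arcsOf (hn : 0 < n) (hm : 0 < m) (hs : 0 < s) (H : IsHeight n m s h) :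
    spokeCount (arcsOf n (heightEdges m h)) = s := by
  have hm' : (0 : ℤ) < m := by exact_mod_cast hm
  have hs' : (0 : ℤ) < s := by exact_mod_cast hs
  choose ρ hρ1 hρ2 using fun j : ℤ => H.exists_record hn hm hs (m * j)
  have huniq : ∀ a b, IsRecord h a → IsRecord h b → h a = h b → a = b := by
    intro a b ha hb hab
    rcases lt_trichotomy a b with hlt | he | hlt
    · have := hb a hlt
      omega
    · exact he
    · have := ha b hlt
      omega
  have hinj : ∀ i j k, ρ j = ρ i + n * k → j = i + s * k := by
    intro i j k hk
    have h1 := H.period_mul (ρ i) k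
    rw [← hk, hρ1, hρ1] at h1
    exact mul_left_cancel₀ hm'.ne' (by linear_combination h1)
  have hset : {i : ZMod n | PuncturedArc.spoke i ∈ arcsOf n (heightEdges m h)} =
      (fun j : ℕ => ((ρ j : ℤ) : ZMod n)) '' (Finset.range s : Set ℕ) := by
    ext i
    obtain ⟨a, rfl⟩ := ZMod.intCast_surjective i
    simp only [Set.mem_ofPred_eq, H.spoke_mem_arcsOf, Set.mem_image, Finset.coe_range, Set.mem_Iio]
    constructor
    · rintro ⟨hr, j, hj⟩
      have e0 := Int.emod_nonneg j hs'.ne'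
      have e1 := Int.emod_lt_of_pos j hs'
      have e := Int.emod_add_mul_ediv j s
      refine ⟨(j % s).toNat, by omega, ?_⟩
      have : a = ρ (j % s).toNat + n * (j / s) := by
        refine huniq _ _ hr (H.isRecord_shift _ (hρ2 _)) ?_
        rw [H.period_mul, hρ1, hj, Int.toNat_of_nonneg e0]
        linear_combination -(m : ℤ) * e
      rw [this]
      push_cast
      simp
    · rintro ⟨j, hj, he⟩
      obtain ⟨k, hk⟩ := (ZMod.intCast_eq_intCast_iff_dvd_sub _ _ _).1 he
      obtain rfl : a = ρ j + n * k := by omega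
      refine ⟨H.isRecord_shift _ (hρ2 _), ?_⟩
      rw [H.period_mul, hρ1]
      exact ⟨j + s * k, by ring⟩
  rw [spokeCount, hset, Set.InjOn.ncard_image, Set.ncard_coe_finset, Finset.card_range]
  intro i hi j hj hij
  simp only [Finset.coe_range, Set.mem_Iio] at hi hj
  obtain ⟨k, hk⟩ := (ZMod.intCast_eq_intCast_iff_dvd_sub _ _ _).1 hij
  have := hinj i j k (by omega)
  have h3 : k < 1 := by
    by_contra hcon
    nlinarith
  have h4 : -1 < k := by
    by_contra hcon
    nlinarith
  obtain rfl : k = 0 := by omega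
  omega

end IsHeight

/-! ### The height function of an angulation -/

/-- An angulation of the cover, with a spoke and invariant under translation by `n`, given by the
set of its edges, where only the cells below arcs are required. -/
structure IsCoverAngulation (n m : ℕ) (E : Set (WithTop ℤ × WithTop ℤ)) : Prop where
  succ_mem : ∀ a : ℤ, ((a : WithTop ℤ), ((a + 1 : ℤ) : WithTop ℤ)) ∈ E
  eq_of_mem : ∀ x y, (x, y) ∈ E →
    ∃ a : ℤ, x = a ∧ (y = ⊤ ∨ ∃ b : ℤ, y = b ∧ a < b ∧ b ≤ a + n)
  not_crossing : ∀ x y z w, (x, y) ∈ E → (z, w) ∈ E → ¬ (x < z ∧ z < y ∧ y < w)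
  cell : ∀ x y, (x, y) ∈ E → (∀ a : ℤ, x = a → y ≠ (a + 1 : ℤ)) → ∃ c, IsCellSeq E m c ∧
    c 0 = x ∧ c (m + 1) = y
  shift : ∀ x y (k : ℤ), (x, y) ∈ E → (coverShift (n * k) x, coverShift (n * k) y) ∈ E
  spoke : ∃ a : ℤ, ((a : WithTop ℤ), (⊤ : WithTop ℤ)) ∈ E

theorem IsAngulation.isCoverAngulation {n m : ℕ} (hn : 0 < n) {T : Set (PuncturedArc n)}
    (hT : IsAngulation m T) (hs : 0 < spokeCount T) : IsCoverAngulation n m (coverEdges T) := by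
  have hn' : (1 : ℤ) ≤ n := by exact_mod_cast hn
  obtain ⟨h1, h2, -⟩ := hT
  have hmem : ∀ x y, (x, y) ∈ coverEdges T → ∃ a : ℤ, x = a ∧ (y = ⊤ ∨ ∃ b : ℤ, y = b ∧ a < b ∧
      b ≤ a + n) := by
    rintro x y (h | ⟨a, ha⟩)
    · obtain ⟨α, -, h⟩ := mem_liftedArcs.1 h
      obtain ⟨a, rfl, rfl | ⟨b, rfl, h3, h4⟩⟩ := PuncturedArc.exists_eq_of_mem_lifts h
      · exact ⟨a, rfl, Or.inl rfl⟩
      · exact ⟨a, rfl, Or.inr ⟨b, rfl, by omega, h4⟩⟩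
    · rw [Prod.mk.injEq] at ha
      exact ⟨a, ha.1, Or.inr ⟨a + 1, ha.2, by omega, by omega⟩⟩
  constructor
  · exact fun a => Or.inr ⟨a, rfl⟩
  · exact hmem
  · rintro x y z w hxy hzw ⟨hc1, hc2, hc3⟩
    rcases hxy with hxy | ⟨a, ha⟩
    · rcases hzw with hzw | ⟨a, ha⟩
      · obtain ⟨α, hα, hxy⟩ := mem_liftedArcs.1 hxy
        obtain ⟨β, hβ, hzw⟩ := mem_liftedArcs.1 hzw
        exact h1 α hα β hβ ⟨_, hxy, _, hzw, Or.inl ⟨hc1, hc2, hc3⟩⟩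
      · rw [Prod.mk.injEq] at ha
        obtain ⟨rfl, rfl⟩ := ha
        obtain ⟨b, rfl⟩ := WithTop.ne_top_iff_exists.1 (ne_top_of_lt hc3)
        rw [WithTop.coe_lt_coe] at hc2 hc3
        omega
    · rw [Prod.mk.injEq] at ha
      obtain ⟨rfl, rfl⟩ := ha
      obtain ⟨b, rfl⟩ := WithTop.ne_top_iff_exists.1 (ne_top_of_lt hc2)
      rw [WithTop.coe_lt_coe] at hc1 hc2
      omega
  · intro x y hxy hne
    have hxy' : (x, y) ∈ liftedArcs T := by
      rcases hxy with h | ⟨a, ha⟩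
      · exact h
      · rw [Prod.mk.injEq] at ha
        exact absurd ha.2 (hne a ha.1)
    obtain ⟨S, hS, hcard, hx, hy, hS'⟩ := h2 x y hxy'
    obtain ⟨c, hc, hcS⟩ := hS.exists_isCellSeq hcard
    refine ⟨c, hc, ?_, ?_⟩
    · obtain ⟨i, hi, rfl⟩ := (hcS x).1 hx
      exact le_antisymm ((hc.le_iff (by omega) hi).2 (by omega))
        (hS' _ ((hcS _).2 ⟨0, by omega, rfl⟩)).1
    · obtain ⟨i, hi, rfl⟩ := (hcS y).1 hy
      exact le_antisymm (hS' _ ((hcS _).2 ⟨m + 1, by omega, rfl⟩)).2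
        ((hc.le_iff hi (by omega)).2 hi)
  · intro x y k hxy
    have hg : ((n * k : ℤ) : ZMod n) = (1 : RotationGroup n).toAdd := by
      push_cast
      simp
    rcases hxy with h | h
    · refine Or.inl ((mem_liftedArcs_smul 1 _ hg T x y).1 ?_)
      rwa [one_smul]
    · exact Or.inr ((mem_liftedBoundary_shift _ x y).1 h)
  · obtain ⟨i, hi⟩ := (Set.ncard_pos (Set.finite_of_ncard_pos hs)).1 hs
    obtain ⟨a, rfl⟩ := ZMod.intCast_surjective i
    exact ⟨a, Or.inl (mem_liftedArcs.2 ⟨_, hi, a, rfl, rfl⟩)⟩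

/-- The number of finite edges in `E` from `a` beyond `b`. -/
noncomputable def outerCount (E : Set (WithTop ℤ × WithTop ℤ)) (a b : ℤ) : ℕ :=
  Set.ncard {b' : ℤ | b < b' ∧ ((a : WithTop ℤ), (b' : WithTop ℤ)) ∈ E}

/-- Every function on `ℤ` is the difference function of some function. -/
theorem Int.exists_forall_succ_eq_add (g : ℤ → ℤ) (x r : ℤ) :
    ∃ h : ℤ → ℤ, h x = r ∧ ∀ a, h (a + 1) = h a + g a := by
  refine ⟨fun a => r + ∑ i ∈ Finset.Ico x a, g i - ∑ i ∈ Finset.Ico a x, g i, by simp,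
    fun a => ?_⟩
  rcases le_or_gt x a with h | h
  · have h1 : Finset.Ico x (a + 1) = insert a (Finset.Ico x a) := by
      ext i; simp only [Finset.mem_Ico, Finset.mem_insert]; omega
    simp only [h1]
    rw [Finset.sum_insert (by simp), Finset.Ico_eq_empty (by omega : ¬ a < x),
      Finset.Ico_eq_empty (by omega : ¬ a + 1 < x)]
    ring
  · have h1 : Finset.Ico a x = insert a (Finset.Ico (a + 1) x) := by
      ext i; simp only [Finset.mem_Ico, Finset.mem_insert]; omega
    simp only [h1]
    rw [Finset.sum_insert (by simp), Finset.Ico_eq_empty (by omega : ¬ x < a),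
      Finset.Ico_eq_empty (by omega : ¬ x < a + 1)]
    ring

namespace IsCoverAngulation

variable {n m : ℕ} {E : Set (WithTop ℤ × WithTop ℤ)}

theorem coe_mem (hE : IsCoverAngulation n m E) {a b : ℤ}
    (h : ((a : WithTop ℤ), (b : WithTop ℤ)) ∈ E) : a < b ∧ b ≤ a + n := by
  obtain ⟨a', ha, hb | ⟨b', hb, h1⟩⟩ := hE.eq_of_mem _ _ h
  · simp at hb
  · rw [WithTop.coe_inj] at ha hb
    subst ha hb
    exact h1

theorem finite_outer (hE : IsCoverAngulation n m E) (a b : ℤ) :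
    {b' : ℤ | b < b' ∧ ((a : WithTop ℤ), (b' : WithTop ℤ)) ∈ E}.Finite :=
  (Set.finite_Ioc a (a + n)).subset fun _ hb' => hE.coe_mem hb'.2

/-- An edge from a vertex of a cell which runs beyond the next vertex runs beyond the last one,
and starts at the first one. -/
theorem beyond_cell (hE : IsCoverAngulation n m E) {c : ℕ → WithTop ℤ} (hc : IsCellSeq E m c)
    {i : ℕ} (hi : i ≤ m) {y : WithTop ℤ} (hy : (c i, y) ∈ E) (hlt : c (i + 1) < y) :
    i = 0 ∧ c (m + 1) ≤ y := by
  by_cases hlast : c (m + 1) < y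
  · refine ⟨?_, hlast.le⟩
    by_contra hne
    exact hE.not_crossing _ _ _ _ ((hc.mem 0 (m + 1) (by omega) le_rfl).2 (by omega)) hy
      ⟨hc.lt _ _ (by omega) (by omega), hc.lt _ _ (by omega) (by omega), hlast⟩
  -- Pushing `y` past one vertex after another: it cannot end strictly inside a side, which it would
  -- cross, and it can end at a vertex after `c (i + 1)` only if it is the long side of the cell.
  · have key : ∀ j, i + 1 ≤ j → j ≤ m + 1 → (c j < y ∨ (i = 0 ∧ c (m + 1) ≤ y)) := by
      intro j hj
      induction j, hj using Nat.le_induction with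
      | base => exact fun _ => Or.inl hlt
      | succ j hj ih =>
        intro hj'
        rcases ih (by omega) with h | h
        · rcases lt_trichotomy (c (j + 1)) y with h' | rfl | h'
          · exact Or.inl h'
          · rw [hc.mem i (j + 1) (by omega) hj'] at hy
            right
            rcases hy with hy | ⟨h1, h2⟩
            · omega
            · exact ⟨h1, by rw [h2]⟩
          · exact absurd ⟨hc.lt i j (by omega) (by omega), h, h'⟩
              (hE.not_crossing _ _ _ _ hy ((hc.mem j (j + 1) (by omega) hj').2 (Or.inl rfl)))
        · exact Or.inr h
    rcases key (m + 1) (by omega) le_rfl with h | h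
    · exact absurd h hlast
    · exact h

theorem outerCount_eq_zero (hE : IsCoverAngulation n m E) {c : ℕ → WithTop ℤ}
    (hc : IsCellSeq E m c) {i : ℕ} (hi : i ≤ m) (h : i ≠ 0 ∨ c (m + 1) = ⊤) {a b : ℤ}
    (ha : c i = a) (hb : c (i + 1) = b) : outerCount E a b = 0 := by
  rw [outerCount, Set.ncard_eq_zero (hE.finite_outer a b), Set.eq_empty_iff_forall_notMem]
  rintro b' ⟨h1, h2⟩
  rw [← ha] at h2
  obtain ⟨h3, h4⟩ := hE.beyond_cell hc hi h2 (by rw [hb]; exact WithTop.coe_lt_coe.2 h1)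
  rcases h with h | h
  · exact h h3
  · rw [h] at h4
    exact absurd h4 (by simp)

/-- By `beyond_cell`, an edge from the first vertex that passes the second one is the long side of
the cell or runs beyond it; the long side accounts for the extra `1`. -/
theorem outerCount_first (hE : IsCoverAngulation n m E) (hm : 0 < m) {c : ℕ → WithTop ℤ}
    (hc : IsCellSeq E m c) {a b b₁ : ℤ} (ha : c 0 = a) (hb₁ : c 1 = b₁) (hb : c (m + 1) = b) :
    outerCount E a b₁ = outerCount E a b + 1 := by
  have hlt : b₁ < b := by
    rw [← WithTop.coe_lt_coe, ← hb₁, ← hb]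
    exact hc.lt _ _ (by omega) le_rfl
  have : {b' : ℤ | b₁ < b' ∧ ((a : WithTop ℤ), (b' : WithTop ℤ)) ∈ E} =
      insert b {b' : ℤ | b < b' ∧ ((a : WithTop ℤ), (b' : WithTop ℤ)) ∈ E} := by
    ext b'
    simp only [Set.mem_ofPred_eq, Set.mem_insert_iff]
    constructor
    · rintro ⟨h1, h2⟩
      rw [← ha] at h2
      have h3 := (hE.beyond_cell hc (Nat.zero_le m) h2
        (by rw [zero_add, hb₁]; exact WithTop.coe_lt_coe.2 h1)).2
      rw [hb, WithTop.coe_le_coe] at h3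
      rw [← ha]
      rcases eq_or_lt_of_le h3 with h4 | h4
      · exact Or.inl h4.symm
      · exact Or.inr ⟨h4, h2⟩
    · rintro (rfl | ⟨h1, h2⟩)
      · refine ⟨hlt, ?_⟩
        rw [← ha, ← hb]
        exact (hc.mem 0 (m + 1) (by omega) le_rfl).2 (by omega)
      · exact ⟨by omega, h2⟩
  rw [outerCount, this, Set.ncard_insert_of_notMem (by simp) (hE.finite_outer a b), outerCount]

/-- The height drop along an edge counts the edges beyond it. -/
theorem height_eq (hE : IsCoverAngulation n m E) (hm : 0 < m) {h : ℤ → ℤ}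
    (hh : ∀ a, h (a + 1) = h a + (1 - m * outerCount E a (a + 1))) (N : ℕ) :
    ∀ a b : ℤ, (b - a).toNat = N → ((a : WithTop ℤ), (b : WithTop ℤ)) ∈ E →
      h b = h a + 1 - m * outerCount E a b ∧ ∀ y, a < y → y < b → h y < h b := by
  induction N using Nat.strong_induction_on with
  | _ N ih =>
  intro a b hN hab
  obtain ⟨hlt, -⟩ := hE.coe_mem hab
  by_cases hb : b = a + 1
  · subst hb
    exact ⟨by rw [hh]; ring, fun y _ _ => by omega⟩
  · obtain ⟨c, hc, hc0, hc1⟩ := hE.cell _ _ hab (by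
      intro a' ha' hb'
      rw [WithTop.coe_inj] at ha' hb'
      omega)
    have hint : ∀ i : ℕ, ∃ g : ℤ, i ≤ m + 1 → c i = g := by
      intro i
      by_cases hi : i ≤ m + 1
      · have : c i ≤ b := by
          rw [← hc1]
          exact (hc.le_iff hi le_rfl).2 hi
        obtain ⟨g, hg⟩ := WithTop.ne_top_iff_exists.1 (ne_top_of_le_ne_top (WithTop.coe_ne_top) this)
        exact ⟨g, fun _ => hg.symm⟩
      · exact ⟨0, fun h => absurd h hi⟩
    choose g hg using hint
    have hglt : ∀ i j, i < j → j ≤ m + 1 → g i < g j := by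
      intro i j hij hj
      rw [← WithTop.coe_lt_coe, ← hg i (by omega), ← hg j hj]
      exact hc.lt i j hij hj
    have hg0 : g 0 = a := by
      rw [← WithTop.coe_inj, ← hg 0 (by omega), hc0]
    have hg1 : g (m + 1) = b := by
      rw [← WithTop.coe_inj, ← hg (m + 1) (by omega), hc1]
    have hside : ∀ i, i ≤ m → h (g (i + 1)) = h (g i) + 1 - m * outerCount E (g i) (g (i + 1)) ∧
        ∀ y, g i < y → y < g (i + 1) → h y < h (g (i + 1)) := by
      intro i hi
      have h1 : a ≤ g i := by
        rcases Nat.eq_zero_or_pos i with rfl | h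
        · exact hg0.ge
        · rw [← hg0]; exact (hglt 0 i h (by omega)).le
      have h2 : g (i + 1) ≤ b := by
        rcases eq_or_lt_of_le hi with rfl | h
        · exact hg1.le
        · rw [← hg1]; exact (hglt (i + 1) (m + 1) (by omega) (by omega)).le
      have h3 : a < g i ∨ g (i + 1) < b := by
        rcases Nat.eq_zero_or_pos i with rfl | h
        · right
          rw [← hg1]; exact hglt _ _ (by omega) (by omega)
        · left
          rw [← hg0]; exact hglt _ _ (by omega) (by omega)
      have h4 := hglt i (i + 1) (by omega) (by omega)
      refine ih (g (i + 1) - g i).toNat (by omega) _ _ rfl ?_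
      rw [← hg i (by omega), ← hg (i + 1) (by omega)]
      exact (hc.mem _ _ (by omega) (by omega)).2 (Or.inl rfl)
    -- After the first side no edge runs beyond a side, so each of the remaining `m` sides climbs by
    -- exactly one. This cancels the extra `-m` that the first side receives from
    -- `outerCount_first`.
    have hlevel : ∀ i, i ≤ m → h (g (i + 1)) = h (g 1) + i := by
      intro i
      induction i with
      | zero => intro _; simp
      | succ i ih' =>
        intro hi
        rw [(hside (i + 1) hi).1, ih' (by omega), hE.outerCount_eq_zero hc hi (Or.inl (by omega))
          (hg _ (by omega)) (hg _ (by omega))]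
        push_cast
        ring
    have hfirst := (hside 0 (by omega)).1
    have hlast := hlevel m le_rfl
    rw [hg1] at hlast
    constructor
    · rw [zero_add, hg0, hE.outerCount_first hm hc hc0 (hg 1 (by omega)) hc1] at hfirst
      rw [hlast, hfirst]
      push_cast
      ring
    · have key : ∀ j, j ≤ m + 1 → ∀ y, a < y → y < g j → h y < h b := by
        intro j
        induction j with
        | zero => intro _ y h1 h2; omega
        | succ j ih' =>
          intro hj y h1 h2
          have hl := hlevel j (by omega)
          rcases lt_trichotomy y (g j) with h3 | rfl | h3
          · exact ih' (by omega) y h1 h3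
          · rcases j with _ | j
            · omega
            · have := hlevel j (by omega)
              omega
          · have := (hside j (by omega)).2 y h3 h2
            omega
      rw [← hg1] at *
      exact key (m + 1) le_rfl

/-- The next spoke after a spoke. -/
theorem exists_next_spoke (hE : IsCoverAngulation n m E) (hm : 0 < m) {h : ℤ → ℤ}
    (hh : ∀ a, h (a + 1) = h a + (1 - m * outerCount E a (a + 1))) {x : ℤ}
    (hx : ((x : WithTop ℤ), (⊤ : WithTop ℤ)) ∈ E) :
    ∃ x', x < x' ∧ ((x' : WithTop ℤ), (⊤ : WithTop ℤ)) ∈ E ∧ h x' = h x + m ∧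
      ∀ y, x < y → y < x' → h y < h x' ∧ ((y : WithTop ℤ), (⊤ : WithTop ℤ)) ∉ E := by
  obtain ⟨c, hc, hc0, hc1⟩ := hE.cell _ _ hx (fun a _ h => WithTop.top_ne_coe h)
  have hint : ∀ i : ℕ, ∃ g : ℤ, i ≤ m → c i = g := by
    intro i
    by_cases hi : i ≤ m
    · have := hc.lt i (m + 1) (by omega) le_rfl
      obtain ⟨g, hg⟩ := WithTop.ne_top_iff_exists.1 (ne_top_of_lt this)
      exact ⟨g, fun _ => hg.symm⟩
    · exact ⟨0, fun h => absurd h hi⟩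
  choose g hg using hint
  have hglt : ∀ i j, i < j → j ≤ m → g i < g j := by
    intro i j hij hj
    rw [← WithTop.coe_lt_coe, ← hg i (by omega), ← hg j hj]
    exact hc.lt i j hij (by omega)
  have hg0 : g 0 = x := by
    rw [← WithTop.coe_inj, ← hg 0 (by omega), hc0]
  have hsideE : ∀ i, i < m → ((g i : WithTop ℤ), (g (i + 1) : WithTop ℤ)) ∈ E := by
    intro i hi
    rw [← hg i (by omega), ← hg (i + 1) (by omega)]
    exact (hc.mem _ _ (by omega) (by omega)).2 (Or.inl rfl)
  have hside := fun i hi => hE.height_eq hm hh _ _ _ rfl (hsideE i hi)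
  -- The last vertex of the cell is the puncture, so no finite edge runs beyond any of the sides,
  -- and all `m` finite sides climb by one.
  have hlevel : ∀ i, i ≤ m → h (g i) = h x + i := by
    intro i
    induction i with
    | zero => intro _; simp [hg0]
    | succ i ih =>
      intro hi
      rw [(hside i (by omega)).1, ih (by omega), hE.outerCount_eq_zero hc (by omega) (Or.inr hc1)
        (hg _ (by omega)) (hg _ (by omega))]
      push_cast
      ring
  have htop : ((g m : WithTop ℤ), (⊤ : WithTop ℤ)) ∈ E := by
    rw [← hc1, ← hg m le_rfl]
    exact (hc.mem _ _ (by omega) le_rfl).2 (Or.inl rfl)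
  refine ⟨g m, by rw [← hg0]; exact hglt 0 m hm le_rfl, htop, hlevel m le_rfl, ?_⟩
  have key : ∀ j, j ≤ m → ∀ y, x < y → y < g j →
      h y < h (g m) ∧ ((y : WithTop ℤ), (⊤ : WithTop ℤ)) ∉ E := by
    intro j
    induction j with
    | zero => intro _ y h1 h2; omega
    | succ j ih =>
      intro hj y h1 h2
      have hlm := hlevel m le_rfl
      have hlj := hlevel j (by omega)
      have hlj' := hlevel (j + 1) (by omega)
      rcases lt_trichotomy y (g j) with h3 | rfl | h3
      · exact ih (by omega) y h1 h3
      · refine ⟨by omega, ?_⟩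
        rw [← hc1, ← hg j (by omega), hc.mem _ _ (by omega) le_rfl]
        rintro (h | h)
        · omega
        · rw [h.1] at h1
          omega
      · have := (hside j (by omega)).2 y h3 h2
        refine ⟨by omega, fun hy => ?_⟩
        exact hE.not_crossing _ _ _ _ (hsideE j (by omega)) hy
          ⟨WithTop.coe_lt_coe.2 h3, WithTop.coe_lt_coe.2 h2, WithTop.coe_lt_top _⟩
  exact key m le_rfl

theorem exists_last_spoke (hE : IsCoverAngulation n m E) (hn : 0 < n) (y : ℤ) :
    ∃ x ≤ y, ((x : WithTop ℤ), (⊤ : WithTop ℤ)) ∈ E ∧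
      ∀ z ≤ y, ((z : WithTop ℤ), (⊤ : WithTop ℤ)) ∈ E → z ≤ x := by
  obtain ⟨a, ha⟩ := hE.spoke
  obtain ⟨x, ⟨h1, h2⟩, h3⟩ := Int.exists_greatest_of_bdd
    (P := fun x : ℤ => x ≤ y ∧ ((x : WithTop ℤ), (⊤ : WithTop ℤ)) ∈ E) ⟨y, fun z hz => hz.1⟩
    ⟨a + n * (-|a - y|), by
      have h1 := le_abs_self (a - y)
      have h2 := abs_nonneg (a - y)
      have : (1 : ℤ) ≤ n := by exact_mod_cast hn
      nlinarith, hE.shift _ _ _ ha⟩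
  exact ⟨x, h1, h2, fun z hz hz' => h3 z ⟨hz, hz'⟩⟩

/-- Every spoke ends at a record, and the heights of all spokes are congruent modulo `m`. -/
theorem height_lt_of_spoke (hE : IsCoverAngulation n m E) (hn : 0 < n) (hm : 0 < m) {h : ℤ → ℤ}
    (hh : ∀ a, h (a + 1) = h a + (1 - m * outerCount E a (a + 1))) {x : ℤ}
    (hx : ((x : WithTop ℤ), (⊤ : WithTop ℤ)) ∈ E) (N : ℕ) : ∀ y, (x - y).toNat = N → y < x →
      h y < h x ∧ (((y : WithTop ℤ), (⊤ : WithTop ℤ)) ∈ E → (m : ℤ) ∣ h x - h y) := by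
  induction N using Nat.strong_induction_on generalizing x with
  | _ N ih =>
  intro y hN hyx
  obtain ⟨w, hw1, hw2, hw3⟩ := hE.exists_last_spoke hn (x - 1)
  obtain ⟨x', h1, h2, h3, h4⟩ := hE.exists_next_spoke hm hh hw2
  obtain rfl : x' = x := by
    rcases lt_trichotomy x' x with hlt | he | hlt
    · have := hw3 x' (by omega) h2
      omega
    · exact he
    · exact absurd hx (h4 x (by omega) hlt).2
  rcases lt_trichotomy y w with hlt | rfl | hlt
  · obtain ⟨h5, h6⟩ := ih (w - y).toNat (by omega) hw2 y rfl hlt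
    refine ⟨by omega, fun hy => ?_⟩
    rw [h3, add_sub_right_comm]
    exact dvd_add (h6 hy) dvd_rfl
  · exact ⟨by omega, fun _ => by rw [h3]; simp⟩
  · exact ⟨(h4 y hlt hyx).1, fun hy => absurd hy (h4 y hlt hyx).2⟩

theorem outerCount_shift (hE : IsCoverAngulation n m E) (a b : ℤ) :
    outerCount E (a + n) (b + n) = outerCount E a b := by
  have hinj : Function.Injective fun b' : ℤ => b' + n := add_left_injective _
  rw [outerCount, outerCount, ← Set.ncard_image_of_injective
    {b' : ℤ | b < b' ∧ ((a : WithTop ℤ), (b' : WithTop ℤ)) ∈ E} hinj]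
  congr 1
  ext b'
  simp only [Set.mem_ofPred_eq, Set.mem_image]
  constructor
  · rintro ⟨h1, h2⟩
    refine ⟨b' - n, ⟨by omega, ?_⟩, by omega⟩
    have := hE.shift _ _ (-1) h2
    rw [coverShift_coe, coverShift_coe] at this
    convert this using 3 <;> omega
  · rintro ⟨b'', ⟨h1, h2⟩, rfl⟩
    refine ⟨by omega, ?_⟩
    have := hE.shift _ _ 1 h2
    rw [coverShift_coe, coverShift_coe, mul_one] at this
    exact this

/-- That edges of `E` are edges of `h` is `height_eq` and `height_lt_of_spoke`. Conversely, the
edges of `E` from `a` already realize every admissible end height, and a first passage is determined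
by its height. A record strictly between two consecutive spokes has height strictly between two
consecutive multiples of `m`, so it carries no spoke. -/
theorem eq_heightEdges (hE : IsCoverAngulation n m E) (hn : 0 < n) (hm : 0 < m) {h : ℤ → ℤ}
    (hh : ∀ a, h (a + 1) = h a + (1 - m * outerCount E a (a + 1))) {x₀ : ℤ}
    (hx₀ : ((x₀ : WithTop ℤ), (⊤ : WithTop ℤ)) ∈ E) (h₀ : h x₀ = 0) : E = heightEdges m h := by
  have hm' : (0 : ℤ) < m := by exact_mod_cast hm
  have hsub : ∀ a b : ℤ, ((a : WithTop ℤ), (b : WithTop ℤ)) ∈ E → HeightEdge m h a b := by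
    intro a b hab
    obtain ⟨h1, h2⟩ := hE.height_eq hm hh _ a b rfl hab
    have : (0 : ℤ) ≤ m * outerCount E a b := by positivity
    exact ⟨(hE.coe_mem hab).1, h2, by omega, ⟨outerCount E a b, by rw [h1]; ring⟩⟩
  have hspoke : ∀ x : ℤ, ((x : WithTop ℤ), (⊤ : WithTop ℤ)) ∈ E → IsRecord h x ∧ (m : ℤ) ∣ h x := by
    intro x hx
    refine ⟨fun y hy => (hE.height_lt_of_spoke hn hm hh hx _ y rfl hy).1, ?_⟩
    rcases lt_trichotomy x x₀ with hlt | rfl | hlt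
    · have := (hE.height_lt_of_spoke hn hm hh hx₀ _ x rfl hlt).2 hx
      rw [h₀, zero_sub] at this
      exact (dvd_neg).1 this
    · rw [h₀]; exact dvd_zero _
    · have := (hE.height_lt_of_spoke hn hm hh hx _ x₀ rfl hlt).2 hx₀
      rwa [h₀, sub_zero] at this
  ext ⟨u, v⟩
  constructor
  · intro huv
    obtain ⟨a, rfl, rfl | ⟨b, rfl, -⟩⟩ := hE.eq_of_mem _ _ huv
    · exact top_mem_heightEdges.2 (hspoke a huv)
    · exact coe_mem_heightEdges.2 (hsub a b huv)
  · rintro (⟨a, b, he, hab⟩ | ⟨y, he, hr, hd⟩)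
    · rw [he]
      by_contra hcon
      -- the edge of `E` from `a` with the least end beyond `b` would have to lie at height `h b`
      obtain ⟨h1, h2, h3, k, hk⟩ := hab
      have hk' : h b = h a + 1 - m * k := by linear_combination -hk
      have hlt : a + 1 < b := by
        refine lt_of_le_of_ne h1 ?_
        rintro rfl
        exact hcon (hE.succ_mem a)
      have hk0 : 0 ≤ k := by
        by_contra hc
        nlinarith
      have hkf : k < outerCount E a (a + 1) := by
        have e1 := h2 (a + 1) (by omega) hlt
        have e2 := hh a
        by_contra hc
        nlinarith
      -- going inwards along the edges from `a`, the outer count takes all values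
      have hall : ∀ j : ℕ, j ≤ outerCount E a (a + 1) →
          ∃ b' : ℤ, ((a : WithTop ℤ), (b' : WithTop ℤ)) ∈ E ∧ outerCount E a b' = j := by
        intro j hj
        obtain ⟨b', ⟨hb1, hb2⟩, hb3⟩ := Int.exists_least_of_bdd
          (P := fun b' : ℤ => ((a : WithTop ℤ), (b' : WithTop ℤ)) ∈ E ∧ outerCount E a b' ≤ j)
          ⟨a, fun z hz => (hE.coe_mem hz.1).1.le⟩ (by
            obtain ⟨b', hb1, hb2⟩ := Int.exists_greatest_of_bdd
              (P := fun b' : ℤ => ((a : WithTop ℤ), (b' : WithTop ℤ)) ∈ E)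
              ⟨a + n, fun z hz => (hE.coe_mem hz).2⟩ ⟨a + 1, hE.succ_mem a⟩
            refine ⟨b', hb1, ?_⟩
            have : outerCount E a b' = 0 := by
              rw [outerCount, Set.ncard_eq_zero (hE.finite_outer a b'),
                Set.eq_empty_iff_forall_notMem]
              rintro z ⟨hz1, hz2⟩
              have := hb2 z hz2
              omega
            omega)
        refine ⟨b', hb1, le_antisymm hb2 ?_⟩
        by_cases hb : b' = a + 1
        · rw [hb]; exact hj
        · -- the edge preceding `b'`
          have hlt' : a + 1 < b' := lt_of_le_of_ne (hE.coe_mem hb1).1 (Ne.symm hb)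
          obtain ⟨w, ⟨hw1, hw2⟩, hw3⟩ := Int.exists_greatest_of_bdd
            (P := fun w : ℤ => ((a : WithTop ℤ), (w : WithTop ℤ)) ∈ E ∧ w < b')
            ⟨b', fun z hz => hz.2.le⟩ ⟨a + 1, hE.succ_mem a, hlt'⟩
          have hset : {z : ℤ | w < z ∧ ((a : WithTop ℤ), (z : WithTop ℤ)) ∈ E} =
              insert b' {z : ℤ | b' < z ∧ ((a : WithTop ℤ), (z : WithTop ℤ)) ∈ E} := by
            ext z
            simp only [Set.mem_ofPred_eq, Set.mem_insert_iff]
            constructor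
            · rintro ⟨hz1, hz2⟩
              rcases lt_trichotomy z b' with h' | h' | h'
              · have := hw3 z ⟨hz2, h'⟩
                omega
              · exact Or.inl h'
              · exact Or.inr ⟨h', hz2⟩
            · rintro (rfl | ⟨hz1, hz2⟩)
              · exact ⟨hw2, hb1⟩
              · exact ⟨by omega, hz2⟩
          have hcount : outerCount E a w = outerCount E a b' + 1 := by
            rw [outerCount, hset, Set.ncard_insert_of_notMem (by simp) (hE.finite_outer a b'),
              outerCount]
          by_contra hc
          have := hb3 w ⟨hw1, by omega⟩
          omega
      obtain ⟨b', hb1, hb2⟩ := hall k.toNat (by omega)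
      have e1 := (hE.height_eq hm hh _ a b' rfl hb1)
      have e2 : h b' = h b := by
        rw [e1.1, hb2, hk', Int.toNat_of_nonneg hk0]
      rcases lt_trichotomy b b' with hlt' | rfl | hlt'
      · have := e1.2 b h1 hlt'
        omega
      · exact hcon hb1
      · have := h2 b' (hE.coe_mem hb1).1 hlt'
        omega
    · rw [he]
      obtain ⟨x, hx1, hx2, hx3⟩ := hE.exists_last_spoke hn y
      obtain ⟨x', hx4, hx5, hx6, hx7⟩ := hE.exists_next_spoke hm hh hx2
      rcases eq_or_lt_of_le hx1 with rfl | hlt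
      · exact hx2
      · exfalso
        have h1 := hr x hlt
        have h2 : y < x' := by
          by_contra hcon
          have := hx3 x' (by omega) hx5
          omega
        have h3 := (hx7 y hlt h2).1
        have h4 : (m : ℤ) ∣ h y - h x := dvd_sub hd (hspoke x hx2).2
        have := Int.le_of_dvd (by omega) h4
        omega

/-- Every angulation of the cover comes from a height function. -/
theorem exists_isHeight (hE : IsCoverAngulation n m E) (hn : 0 < n) (hm : 0 < m) :
    ∃ h s, 0 < s ∧ IsHeight n m s h ∧ E = heightEdges m h := by
  obtain ⟨x₀, hx₀⟩ := hE.spoke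
  obtain ⟨h, h₀, hh⟩ := Int.exists_forall_succ_eq_add (fun a => 1 - m * outerCount E a (a + 1)) x₀ 0
  have hEh := hE.eq_heightEdges hn hm hh hx₀ h₀
  -- The steps of `h` are outer counts, which are `n`-periodic, so the gain over a period is
  -- constant. It equals the height of the spoke at `x₀ + n`, hence is a positive multiple of `m`.
  have hper : ∀ a, h (a + n) = h a + h (x₀ + n) := by
    intro a
    have hs : ∀ a, h (a + 1 + n) - h (a + 1) = h (a + n) - h a := by
      intro a
      have e := hh (a + n)
      rw [show a + (n : ℤ) + 1 = a + 1 + n by ring, hE.outerCount_shift] at e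
      rw [e, hh]
      ring
    have hall : ∀ k : ℤ, h (x₀ + k + n) - h (x₀ + k) = h (x₀ + n) - h x₀ := by
      intro k
      induction k using Int.induction_on with
      | zero => simp
      | succ i ih => rw [← ih, ← hs (x₀ + i), add_assoc x₀ (i : ℤ) 1]
      | pred i ih => rw [← ih, ← hs, show x₀ + (-(i : ℤ) - 1) + 1 = x₀ + -i by ring]
    have := hall (a - x₀)
    rw [add_sub_cancel, h₀] at this
    linarith
  have hx₁ : ((x₀ + n : ℤ) : WithTop ℤ) = coverShift (n * 1) (x₀ : WithTop ℤ) := by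
    rw [coverShift_coe, mul_one]
  have hx₁E : (((x₀ + n : ℤ) : WithTop ℤ), (⊤ : WithTop ℤ)) ∈ E := by
    rw [hx₁]
    exact hE.shift _ _ 1 hx₀
  rw [hEh] at hx₁E
  obtain ⟨hr, t, ht⟩ := top_mem_heightEdges.1 hx₁E
  have hpos := hr x₀ (by omega)
  rw [h₀, ht] at hpos
  have ht0 : 0 < t := by
    have : (0 : ℤ) < m := by exact_mod_cast hm
    by_contra hcon
    nlinarith
  refine ⟨h, t.toNat, by omega, ⟨fun a => ⟨outerCount E a (a + 1), ?_⟩, fun a => ?_⟩, hEh⟩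
  · rw [hh]; ring
  · rw [hper, ht, Int.toNat_of_nonneg ht0.le]

end IsCoverAngulation

/-! ### Uniqueness of the height function -/

/-- The steps of `h` can be recovered from its edges: `h` maps the ends of the edges from `a` beyond
`a + 1` bijectively onto the levels `h a + 1 - m * i` above `h (a + 1)`. First passage gives
surjectivity, and two ends at equal height would contradict strictness along the longer edge. -/
theorem IsHeight.apply_succ_eq {n m s : ℕ} {h : ℤ → ℤ} (hm : 0 < m) (hs : 0 < s)
    (H : IsHeight n m s h) (a : ℤ) :
    h (a + 1) = h a + 1 - m * outerCount (heightEdges m h) a (a + 1) := by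
  obtain ⟨f, hf⟩ := H.step a
  have hm' : (0 : ℤ) < m := by exact_mod_cast hm
  suffices outerCount (heightEdges m h) a (a + 1) = f by rw [this, hf]
  have hinj : Set.InjOn h {b : ℤ | a + 1 < b ∧
      ((a : WithTop ℤ), (b : WithTop ℤ)) ∈ heightEdges m h} := by
    rintro b ⟨hb, hb'⟩ c ⟨hc, hc'⟩ hbc
    rw [coe_mem_heightEdges] at hb' hc'
    rcases lt_trichotomy b c with hlt | he | hlt
    · have := hc'.2.1 b (by omega) hlt
      omega
    · exact he
    · have := hb'.2.1 c (by omega) hlt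
      omega
  have himg : h '' {b : ℤ | a + 1 < b ∧ ((a : WithTop ℤ), (b : WithTop ℤ)) ∈ heightEdges m h} =
      (fun i : ℕ => h a + 1 - m * i) '' (Finset.range f : Set ℕ) := by
    ext L
    simp only [Set.mem_image, Set.mem_ofPred_eq, coe_mem_heightEdges, Finset.coe_range, Set.mem_Iio]
    constructor
    · rintro ⟨b, ⟨h1, h2⟩, rfl⟩
      obtain ⟨-, h3, h4, k, hk⟩ := h2
      have e1 := h3 (a + 1) (by omega) h1
      have hk0 : 0 ≤ k := by
        by_contra hc
        nlinarith
      have hkf : k < f := by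
        by_contra hc
        nlinarith
      refine ⟨k.toNat, by omega, ?_⟩
      rw [Int.toNat_of_nonneg hk0]
      linear_combination hk
    · rintro ⟨i, hi, rfl⟩
      have hi' : (i : ℤ) + 1 ≤ f := by exact_mod_cast hi
      have hL : h (a + 1) < h a + 1 - m * i := by
        rw [hf]
        nlinarith
      obtain ⟨q, h1, h2, h3⟩ := H.exists_passage hm hs hL.le
      have hq : a + 1 < q := by
        refine lt_of_le_of_ne h1 ?_
        rintro rfl
        omega
      refine ⟨q, ⟨hq, by omega, fun c hc hcq => ?_, ?_, ?_⟩, h2⟩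
      · rw [h2]; exact h3 c (by omega) hcq
      · rw [h2]
        have : (0 : ℤ) ≤ m * i := by positivity
        omega
      · rw [h2]; exact ⟨i, by ring⟩
  rw [outerCount, ← hinj.ncard_image, himg, Set.ncard_image_of_injective, Set.ncard_coe_finset,
    Finset.card_range]
  intro i j hij
  have : (m : ℤ) * i = m * j := by
    have := hij
    simp only at this
    linarith
  exact_mod_cast mul_left_cancel₀ hm'.ne' this

/-- Equal edges give equal steps, so the difference is constant; at a common spoke both heights are
divisible by `m`, so the constant is as well. -/
theorem IsHeight.sub_eq_of_heightEdges_eq {n m s s' : ℕ} {h h' : ℤ → ℤ} (hn : 0 < n) (hm : 0 < m)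
    (hs : 0 < s) (hs' : 0 < s') (H : IsHeight n m s h) (H' : IsHeight n m s' h')
    (he : heightEdges m h = heightEdges m h') : ∃ k : ℤ, ∀ a, h' a = h a + m * k := by
  have hstep : ∀ a, h' (a + 1) - h (a + 1) = h' a - h a := by
    intro a
    rw [H.apply_succ_eq hm hs, H'.apply_succ_eq hm hs', he]
    ring
  have hall : ∀ a, h' a - h a = h' 0 - h 0 := by
    intro a
    induction a using Int.induction_on with
    | zero => rfl
    | succ i ih => rw [hstep, ih]
    | pred i ih => rw [← ih, ← hstep, sub_add_cancel]
  obtain ⟨x, hx, hr⟩ := H.exists_record hn hm hs 0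
  have hmem := top_mem_heightEdges.2 ⟨hr, hx ▸ dvd_zero (m : ℤ)⟩
  rw [he] at hmem
  obtain ⟨k, hk⟩ := (top_mem_heightEdges.1 hmem).2
  refine ⟨k, fun a => ?_⟩
  have e1 := hall a
  have e2 := hall x
  linarith

/-! ### Gaussian binomial coefficients at roots of unity -/

section RootsOfUnity

open PowerSeries

/-- This is the `q`-Pascal recursion, read off coefficient by coefficient. -/
theorem qBinomial_powerSeries_succ (ζ : ℂ) (k : ℕ) :
    (1 - C (ζ ^ (k + 1)) * X) *
      (PowerSeries.mk fun j => Polynomial.aeval ζ (qBinomial (k + 1 + j) (k + 1))) =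
      PowerSeries.mk fun j => Polynomial.aeval ζ (qBinomial (k + j) k) := by
  ext j
  rw [sub_mul, one_mul, map_sub, mul_assoc, coeff_C_mul]
  cases j with
  | zero =>
    simp only [coeff_mk, coeff_zero_X_mul, mul_zero, sub_zero, add_zero]
    rw [qBinomial, qBinomial_eq_zero_of_lt (Nat.lt_succ_self k), mul_zero, add_zero]
  | succ j =>
    simp only [coeff_mk, coeff_succ_X_mul]
    rw [show k + 1 + (j + 1) = (k + 1 + j) + 1 by omega, qBinomial,
      show k + (j + 1) = k + 1 + j by omega]
    simp

theorem prod_mul_qBinomial_powerSeries (ζ : ℂ) (k : ℕ) :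
    (∏ i ∈ Finset.range (k + 1), (1 - C (ζ ^ i) * X)) *
      (PowerSeries.mk fun j => Polynomial.aeval ζ (qBinomial (k + j) k)) = 1 := by
  induction k with
  | zero =>
    ext j
    simp only [Finset.prod_range_succ, Finset.prod_range_zero, one_mul, pow_zero, map_one, sub_mul,
      map_sub]
    cases j with
    | zero => simp [qBinomial]
    | succ j => simp [qBinomial, coeff_succ_X_mul, coeff_one]
  | succ k ih =>
    rw [Finset.prod_range_succ, mul_assoc, qBinomial_powerSeries_succ, ih]

/-- Pascal's rule for `multichoose`, spread out to the exponents divisible by `d`; iterated, it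
identifies the coefficients of `(1 - X ^ d)⁻ᴷ`. -/
theorem one_sub_X_pow_mul_multichoose_powerSeries {d : ℕ} (hd : 0 < d) (K : ℕ) :
    (1 - X ^ d : PowerSeries ℂ) *
      (PowerSeries.mk fun j => if d ∣ j then (((K + 1).multichoose (j / d) : ℕ) : ℂ) else 0) =
      PowerSeries.mk fun j => if d ∣ j then ((K.multichoose (j / d) : ℕ) : ℂ) else 0 := by
  ext j
  rw [sub_mul, one_mul, map_sub, coeff_X_pow_mul']
  simp only [coeff_mk]
  by_cases hj : d ∣ j
  · obtain ⟨i, rfl⟩ := hj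
    cases i with
    | zero =>
      simp [hd.ne']
    | succ i =>
      have h1 : d ≤ d * (i + 1) := Nat.le_mul_of_pos_right d (by omega)
      have h2 : d * (i + 1) - d = d * i := by rw [mul_add, mul_one]; omega
      rw [if_pos h1, h2]
      simp only [dvd_mul_right, if_true, Nat.mul_div_cancel_left _ hd]
      rw [Nat.multichoose_succ_succ]
      push_cast
      ring
  · rw [if_neg hj, if_neg hj]
    split_ifs with h1 h2
    · exact absurd ((Nat.dvd_sub_iff_left h1 dvd_rfl).1 h2) hj
    · simp
    · simp

theorem one_sub_X_pow_pow_mul_multichoose_powerSeries {d : ℕ} (hd : 0 < d) (K : ℕ) :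
    (1 - X ^ d : PowerSeries ℂ) ^ K *
      (PowerSeries.mk fun j => if d ∣ j then ((K.multichoose (j / d) : ℕ) : ℂ) else 0) = 1 := by
  induction K with
  | zero =>
    ext j
    rw [pow_zero, one_mul, coeff_mk, coeff_one]
    by_cases hj : d ∣ j
    · obtain ⟨i, rfl⟩ := hj
      cases i with
      | zero => simp
      | succ i => simp [Nat.mul_div_cancel_left _ hd, hd.ne']
    · rw [if_neg hj, if_neg]
      rintro rfl
      exact hj (dvd_zero d)
  | succ K ih => rw [pow_succ, mul_assoc, one_sub_X_pow_mul_multichoose_powerSeries hd, ih]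

/-- The constant series `C ζ` is still a primitive root in the domain of power series, so this is
the factorization of `1 ^ d - X ^ d` over the `d`-th roots of unity. -/
theorem IsPrimitiveRoot.prod_one_sub_C_pow_mul_X {ζ : ℂ} {d : ℕ} (hζ : IsPrimitiveRoot ζ d)
    (hd : 0 < d) :
    ∏ i ∈ Finset.range d, (1 - C (ζ ^ i) * X : PowerSeries ℂ) = 1 - X ^ d := by
  have hζ' : IsPrimitiveRoot (C ζ : PowerSeries ℂ) d :=
    hζ.map_of_injective (f := (C : ℂ →+* PowerSeries ℂ)) C_injective
  have h := hζ'.pow_sub_pow_eq_prod_sub_mul 1 (X : PowerSeries ℂ) hd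
  rw [one_pow] at h
  rw [h]
  classical
  have himg : Polynomial.nthRootsFinset d (1 : PowerSeries ℂ) =
      (Finset.range d).image fun i => (C ζ : PowerSeries ℂ) ^ i := by
    symm
    apply Finset.eq_of_subset_of_card_le
    · intro x hx
      obtain ⟨i, -, rfl⟩ := Finset.mem_image.1 hx
      rw [Polynomial.mem_nthRootsFinset hd, ← pow_mul, mul_comm, pow_mul, hζ'.pow_eq_one, one_pow]
    · rw [hζ'.card_nthRootsFinset, Finset.card_image_of_injOn, Finset.card_range]
      intro i hi j hj hij
      exact hζ'.pow_inj (by simpa using hi) (by simpa using hj) hij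
  rw [himg, Finset.prod_image]
  · simp
  · intro i hi j hj hij
    exact hζ'.pow_inj (by simpa using hi) (by simpa using hj) hij

theorem IsPrimitiveRoot.prod_one_sub_C_pow_mul_X_mul {ζ : ℂ} {d : ℕ} (hζ : IsPrimitiveRoot ζ d)
    (hd : 0 < d) (K : ℕ) :
    ∏ i ∈ Finset.range (d * K), (1 - C (ζ ^ i) * X : PowerSeries ℂ) = (1 - X ^ d) ^ K := by
  induction K with
  | zero => simp
  | succ K ih =>
    rw [mul_add, mul_one, Finset.prod_range_add, ih, pow_succ, ← hζ.prod_one_sub_C_pow_mul_X hd]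
    congr 1
    refine Finset.prod_congr rfl fun i _ => ?_
    rw [pow_add, pow_mul, hζ.pow_eq_one, one_pow, one_mul]

/-- Both sides are coefficients of an inverse of `(1 - X ^ d) ^ K`, and inverses are unique. -/
theorem IsPrimitiveRoot.aeval_qBinomial {ζ : ℂ} {d : ℕ} (hζ : IsPrimitiveRoot ζ d) (hd : 0 < d)
    {K : ℕ} (hK : 0 < K) (j : ℕ) :
    Polynomial.aeval ζ (qBinomial (d * K - 1 + j) (d * K - 1)) =
      if d ∣ j then ((K.multichoose (j / d) : ℕ) : ℂ) else 0 := by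
  have hdK : d * K - 1 + 1 = d * K := Nat.sub_add_cancel (Nat.mul_pos hd hK)
  have h1 := prod_mul_qBinomial_powerSeries ζ (d * K - 1)
  rw [hdK, hζ.prod_one_sub_C_pow_mul_X_mul hd] at h1
  have h2 := one_sub_X_pow_pow_mul_multichoose_powerSeries hd K
  have h3 := mul_left_cancel₀ (left_ne_zero_of_mul_eq_one h1) (h1.trans h2.symm)
  simpa using congrArg (coeff j) h3

end RootsOfUnity

/-! ### Counting height functions -/

/-- Height functions up to a multiple of `m`. -/
abbrev NormalizedHeight (n m s : ℕ) : Type :=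
  {h : ℤ → ℤ // IsHeight n m s h ∧ 0 ≤ h 0 ∧ h 0 < m}

theorem IsHeight.forall_shift {n m s : ℕ} {h : ℤ → ℤ} (H : IsHeight n m s h) (a k : ℤ) :
    h (a + n * k + 1) - h (a + n * k) = h (a + 1) - h a := by
  rw [show a + (n : ℤ) * k + 1 = a + 1 + n * k by ring, H.period_mul, H.period_mul]
  ring

theorem Int.apply_natCast_eq_add_sum {h g : ℤ → ℤ} (hg : ∀ a, h (a + 1) = h a + g a) (k : ℕ) :
    h k = h 0 + ∑ i ∈ Finset.range k, g i := by
  induction k with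
  | zero => simp
  | succ k ih =>
    rw [Finset.sum_range_succ, ← add_assoc, ← ih]
    push_cast
    exact hg k

/-- Extend `f` periodically and sum the steps `1 - m * f`. The condition on the sum says precisely
that a period gains `n - m * ∑ f = m * s`. -/
theorem exists_isHeight_of_steps {n m s : ℕ} (hn : 0 < n) (f : Fin n → ℕ)
    (hf : n = m * (s + ∑ i, f i)) (r : ℤ) :
    ∃ h, IsHeight n m s h ∧ h 0 = r ∧ ∀ i : Fin n, h (i + 1) = h i + 1 - m * f i := by
  have hn' : (0 : ℤ) < n := by exact_mod_cast hn
  let f' : ℤ → ℕ := fun a => f ⟨(a % n).toNat, by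
    have h0 := Int.emod_nonneg a hn'.ne'
    have h1 := Int.emod_lt_of_pos a hn'
    omega⟩
  obtain ⟨h, h0, hh⟩ := Int.exists_forall_succ_eq_add (fun a => 1 - m * f' a) 0 r
  have hf' : ∀ i : Fin n, f' i = f i := by
    intro i
    simp only [f']
    congr 1
    ext
    have : ((i : ℕ) : ℤ) % n = (i : ℕ) := Int.emod_eq_of_lt (by positivity) (by exact_mod_cast i.2)
    simp only [this, Int.toNat_natCast]
  have hconst : ∀ a, h (a + n) - h a = h n - h 0 := by
    have hstep : ∀ a, h (a + 1 + n) - h (a + 1) = h (a + n) - h a := by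
      intro a
      have e : f' (a + n) = f' a := by simp [f']
      rw [show a + 1 + (n : ℤ) = a + n + 1 by ring, hh, hh, e]
      ring
    intro a
    induction a using Int.induction_on with
    | zero => simp
    | succ i ih => rw [← ih, hstep]
    | pred i ih => rw [← ih, ← hstep, sub_add_cancel]
  have htotal : h n - h 0 = m * s := by
    rw [Int.apply_natCast_eq_add_sum hh, add_sub_cancel_left, Finset.sum_range]
    simp only [hf', Finset.sum_sub_distrib, ← Finset.mul_sum]
    have : (n : ℤ) = m * (s + ∑ i, (f i : ℤ)) := by exact_mod_cast hf
    simp only [Finset.sum_const, Finset.card_univ, Fintype.card_fin, nsmul_eq_mul, mul_one]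
    linarith
  refine ⟨h, ⟨fun a => ⟨f' a, by rw [hh]; ring⟩, fun a => ?_⟩, h0, fun i => by rw [hh, hf']; ring⟩
  have := hconst a
  linarith

theorem IsHeight.ext_steps {n m s : ℕ} (hn : 0 < n) {h h' : ℤ → ℤ} (H : IsHeight n m s h)
    (H' : IsHeight n m s h') (h0 : h 0 = h' 0)
    (hstep : ∀ i : Fin n, h (i + 1) - h i = h' (i + 1) - h' i) : h = h' := by
  have hn' : (0 : ℤ) < n := by exact_mod_cast hn
  have key : ∀ a, h (a + 1) - h a = h' (a + 1) - h' a := by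
    intro a
    have e0 := Int.emod_nonneg a hn'.ne'
    have e1 := Int.emod_lt_of_pos a hn'
    have e := Int.emod_add_mul_ediv a n
    have h1 := H.forall_shift (a % n) (a / n)
    have h2 := H'.forall_shift (a % n) (a / n)
    rw [e] at h1 h2
    have h3 := hstep ⟨(a % n).toNat, by omega⟩
    simp only [Int.toNat_of_nonneg e0] at h3
    rw [h1, h2, h3]
  funext a
  induction a using Int.induction_on with
  | zero => exact h0
  | succ i ih => linarith [key i]
  | pred i ih =>
    have := key (-i - 1)
    rw [sub_add_cancel] at this
    linarith

/-- A normalized height function is given by its value at `0` and by its steps. -/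
noncomputable def normalizedHeightEquiv {n m s : ℕ} (hn : 0 < n) (hm : 0 < m) :
    Fin m × {f : Fin n → ℕ // n = m * (s + ∑ i, f i)} ≃ NormalizedHeight n m s := by
  have hm' : (m : ℤ) ≠ 0 := by exact_mod_cast hm.ne'
  choose h hh using fun p : Fin m × {f : Fin n → ℕ // n = m * (s + ∑ i, f i)} =>
    exists_isHeight_of_steps hn p.2.1 p.2.2 (p.1 : ℕ)
  refine Equiv.ofBijective (fun p => ⟨h p, (hh p).1, ?_, ?_⟩) ⟨?_, ?_⟩
  · rw [(hh p).2.1]; positivity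
  · rw [(hh p).2.1]; exact_mod_cast p.1.2
  · intro p q hpq
    have he : h p = h q := congrArg Subtype.val hpq
    obtain ⟨-, p1, p2⟩ := hh p
    obtain ⟨-, q1, q2⟩ := hh q
    refine Prod.ext (Fin.ext ?_) (Subtype.ext (funext fun i => ?_))
    · rw [he, q1] at p1
      exact_mod_cast p1.symm
    · have h1 := p2 i
      rw [he, q2 i] at h1
      have h2 : (m : ℤ) * p.2.1 i = m * q.2.1 i := by linarith
      exact_mod_cast mul_left_cancel₀ hm' h2
  · rintro ⟨h', H', h1, h2⟩
    choose f hf using H'.step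
    have hsum : n = m * (s + ∑ i : Fin n, f ((i : ℕ) : ℤ)) := by
      have e1 := Int.apply_natCast_eq_add_sum (h := h') (g := fun a => 1 - m * f a)
        (fun a => by rw [hf]; ring) n
      have e2 := H'.period 0
      rw [zero_add] at e2
      rw [e2, Finset.sum_range] at e1
      simp only [Finset.sum_sub_distrib, ← Finset.mul_sum, Finset.sum_const, Finset.card_univ,
        Fintype.card_fin, nsmul_eq_mul, mul_one] at e1
      have : (n : ℤ) = m * (s + ∑ i : Fin n, (f ((i : ℕ) : ℤ) : ℤ)) := by linarith
      exact_mod_cast this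
    let p : Fin m × {f : Fin n → ℕ // n = m * (s + ∑ i, f i)} :=
      (⟨(h' 0).toNat, by omega⟩, ⟨fun i => f ((i : ℕ) : ℤ), hsum⟩)
    refine ⟨p, Subtype.ext ?_⟩
    obtain ⟨p0, p1, p2⟩ := hh p
    refine p0.ext_steps hn H' ?_ fun i => ?_
    · rw [p1]; exact Int.toNat_of_nonneg h1
    · change h p (i + 1) - h p i = h' (i + 1) - h' i
      rw [p2 i, hf]
      ring

theorem isEmpty_normalizedHeight {n m s : ℕ} (hn : 0 < n) (hm : 0 < m)
    (h : ∀ F, n ≠ m * (s + F)) : IsEmpty (NormalizedHeight n m s) :=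
  ⟨fun H => h _ ((normalizedHeightEquiv hn hm).symm H).2.2⟩

/-- The steps of a height function as a multiset. -/
noncomputable def stepsEquivSym {n m s F : ℕ} (hm : 0 < m) (h : n = m * (s + F)) :
    {f : Fin n → ℕ // n = m * (s + ∑ i, f i)} ≃ Sym (Fin n) F :=
  (Equiv.subtypeEquivRight fun f => by
    constructor
    · intro hf
      have := Nat.eq_of_mul_eq_mul_left hm (hf.symm.trans h)
      omega
    · intro hf
      rw [hf]
      exact h).trans (Sym.equivNatSumOfFintype (Fin n) F).symm

theorem card_normalizedHeight {n m s F : ℕ} (hn : 0 < n) (hm : 0 < m) (h : n = m * (s + F)) :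
    Nat.card (NormalizedHeight n m s) = m * n.multichoose F := by
  rw [← Nat.card_congr (normalizedHeightEquiv hn hm), Nat.card_prod,
    Nat.card_congr (stepsEquivSym hm h), Nat.card_eq_fintype_card, Fintype.card_fin,
    Nat.card_eq_fintype_card, Sym.card_sym_eq_multichoose, Fintype.card_fin]

theorem finite_normalizedHeight {n m s : ℕ} (hn : 0 < n) (hm : 0 < m) :
    Finite (NormalizedHeight n m s) := by
  by_cases h : ∃ F, n = m * (s + F)
  · obtain ⟨F, hF⟩ := h
    have : Finite {f : Fin n → ℕ // n = m * (s + ∑ i, f i)} :=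
      Finite.of_equiv _ (stepsEquivSym hm hF).symm
    exact Finite.of_equiv _ (normalizedHeightEquiv hn hm)
  · push Not at h
    have := isEmpty_normalizedHeight hn hm h
    infer_instance

/-! ### Rotations and height functions -/

theorem heightEdges_add_mul (m : ℕ) (h : ℤ → ℤ) (k : ℤ) :
    heightEdges m (fun a => h a + m * k) = heightEdges m h := by
  ext ⟨x, y⟩
  have h1 : ∀ a b, HeightEdge m (fun a => h a + m * k) a b ↔ HeightEdge m h a b := by
    intro a b
    simp only [HeightEdge, add_lt_add_iff_right, add_sub_add_right_eq_sub,
      add_right_comm _ ((m : ℤ) * k) 1, add_le_add_iff_right]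
  have h2 : ∀ a, (IsRecord (fun a => h a + m * k) a ∧ (m : ℤ) ∣ h a + m * k) ↔
      (IsRecord h a ∧ (m : ℤ) ∣ h a) := by
    intro a
    simp only [IsRecord, add_lt_add_iff_right, dvd_add_left (dvd_mul_right (m : ℤ) k)]
  simp only [heightEdges, Set.mem_ofPred_eq, h1, h2]

theorem heightEdges_comp_shift (m : ℕ) (h : ℤ → ℤ) (c : ℤ) (x y : WithTop ℤ) :
    (x, y) ∈ heightEdges m (fun a => h (a + c)) ↔
      (coverShift c x, coverShift c y) ∈ heightEdges m h := by
  cases x with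
  | top => exact iff_of_false top_fst_notMem_heightEdges top_fst_notMem_heightEdges
  | coe a =>
    cases y with
    | top =>
      rw [coverShift_coe, coverShift_top, top_mem_heightEdges, top_mem_heightEdges]
      refine and_congr_left fun _ => ⟨fun hr b hb => ?_, fun hr b hb => hr _ (by omega)⟩
      have : h (b - c + c) < h (a + c) := hr (b - c) (by omega)
      rwa [sub_add_cancel] at this
    | coe b =>
      rw [coverShift_coe, coverShift_coe, coe_mem_heightEdges, coe_mem_heightEdges]
      refine and_congr (by omega) (and_congr_left fun _ => ⟨fun hr d hd hd' => ?_,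
        fun hr d hd hd' => hr _ (by omega) (by omega)⟩)
      have : h (d - c + c) < h (b + c) := hr (d - c) (by omega) (by omega)
      rwa [sub_add_cancel] at this

theorem IsHeight.comp_shift {n m s : ℕ} {h : ℤ → ℤ} (H : IsHeight n m s h) (c : ℤ) :
    IsHeight n m s fun a => h (a + c) where
  step a := by
    obtain ⟨k, hk⟩ := H.step (a + c)
    exact ⟨k, by rw [add_right_comm]; exact hk⟩
  period a := by
    rw [add_right_comm]
    exact H.period (a + c)

theorem IsHeight.add_mul {n m s : ℕ} {h : ℤ → ℤ} (H : IsHeight n m s h) (k : ℤ) :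
    IsHeight n m s fun a => h a + m * k where
  step a := by
    obtain ⟨l, hl⟩ := H.step a
    exact ⟨l, by rw [hl]; ring⟩
  period a := by rw [H.period a]; ring

/-- This lets a height function of the small period also serve as one for the `d * n`-gon; such
functions encode the angulations with rotational symmetry. -/
theorem IsHeight.mul_period {n m s : ℕ} {h : ℤ → ℤ} (H : IsHeight n m s h) (d : ℕ) :
    IsHeight (d * n) m (d * s) h where
  step := H.step
  period a := by
    have := H.period_mul a d
    push_cast
    rw [mul_comm (d : ℤ) n, this]
    ring

theorem toAdd_rotationGenerator_pow (n k : ℕ) :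
    ((k : ℤ) : ZMod n) = (rotationGenerator n ^ k).toAdd := by
  simp [rotationGenerator]

/-- A rotation by `k` fixes the angulation of a height function `h` if and only if `h` has a
quasi-period `k`. -/
theorem IsHeight.smul_arcsOf_eq_iff {n m s : ℕ} {h : ℤ → ℤ} (hn : 0 < n) (hm : 0 < m) (hs : 0 < s)
    (H : IsHeight n m s h) (k : ℕ) :
    rotationGenerator n ^ k • arcsOf n (heightEdges m h) = arcsOf n (heightEdges m h) ↔
      ∃ l : ℤ, ∀ a, h (a + k) = h a + m * l := by
  have h1 : coverEdges (rotationGenerator n ^ k • arcsOf n (heightEdges m h)) =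
      heightEdges m fun a => h (a + k) := by
    ext ⟨x, y⟩
    rw [heightEdges_comp_shift]
    conv_rhs => rw [← H.coverEdges_arcsOf hn hm hs]
    exact or_congr (mem_liftedArcs_smul _ k (toAdd_rotationGenerator_pow n k) _ x y)
      (mem_liftedBoundary_shift _ x y)
  rw [← (coverEdges_injective hn).eq_iff, h1, H.coverEdges_arcsOf hn hm hs]
  constructor
  · intro he
    exact H.sub_eq_of_heightEdges_eq hn hm hs hs (H.comp_shift k) he.symm
  · rintro ⟨l, hl⟩
    simp only [hl]
    exact heightEdges_add_mul m h l

theorem IsAngulation.exists_isHeight {n m : ℕ} (hn : 0 < n) (hm : 0 < m)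
    {T : Set (PuncturedArc n)} (hT : IsAngulation m T) (hs : 0 < spokeCount T) :
    ∃ h, IsHeight n m (spokeCount T) h ∧ (0 ≤ h 0 ∧ h 0 < m) ∧
      T = arcsOf n (heightEdges m h) := by
  obtain ⟨h, s, hs', H, he⟩ := (hT.isCoverAngulation hn hs).exists_isHeight hn hm
  have hTe : T = arcsOf n (heightEdges m h) := by rw [← he, arcsOf_coverEdges hn]
  have hcount : spokeCount T = s := by
    rw [hTe]
    exact H.spokeCount_arcsOf hn hm hs'
  have hm' : (0 : ℤ) < m := by exact_mod_cast hm
  -- Adding a multiple of `m` does not change the edges, so `h 0` may be replaced by its remainder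
  -- modulo `m`.
  refine ⟨fun a => h a + m * (-(h 0 / m)), ?_, ?_, ?_⟩
  · rw [hcount]
    exact H.add_mul _
  · have e := Int.emod_add_mul_ediv (h 0) m
    have e0 := Int.emod_nonneg (h 0) hm'.ne'
    have e1 := Int.emod_lt_of_pos (h 0) hm'
    constructor <;> linarith
  · rw [heightEdges_add_mul, hTe]

theorem mem_fixedBy_iff {n m s : ℕ} (g : RotationGroup n) (T : SpokeAngulation n m s) :
    T ∈ MulAction.fixedBy (SpokeAngulation n m s) g ↔ g • T.1 = T.1 :=
  Subtype.ext_iff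

/-- Angulations which are invariant under a rotation by `n` are given by height functions of
period `n`. -/
noncomputable def fixedByEquiv {n m s d : ℕ} (hn : 0 < n) (hm : 0 < m) (hs : 0 < s) (hd : 0 < d) :
    NormalizedHeight n m s ≃
      MulAction.fixedBy (SpokeAngulation (d * n) m (d * s)) (rotationGenerator (d * n) ^ n) := by
  have hdn := Nat.mul_pos hd hn
  have hds := Nat.mul_pos hd hs
  have hm' : (0 : ℤ) < m := by exact_mod_cast hm
  refine Equiv.ofBijective (fun h => ⟨⟨arcsOf (d * n) (heightEdges m h.1),
    (h.2.1.mul_period d).isAngulation hdn hm hds,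
    (h.2.1.mul_period d).spokeCount_arcsOf hdn hm hds⟩, ?_⟩) ⟨?_, ?_⟩
  · exact (mem_fixedBy_iff _ _).2 <| ((h.2.1.mul_period d).smul_arcsOf_eq_iff hdn hm hds n).2 ⟨s, h.2.1.period⟩
  · intro h h' he
    have he' : arcsOf (d * n) (heightEdges m h.1) = arcsOf (d * n) (heightEdges m h'.1) :=
      congrArg (fun T => T.1.1) he
    have H := h.2.1.mul_period d
    have H' := h'.2.1.mul_period d
    obtain ⟨k, hk⟩ := H.sub_eq_of_heightEdges_eq hdn hm hds hds H' (by
      rw [← H.coverEdges_arcsOf hdn hm hds, he', H'.coverEdges_arcsOf hdn hm hds])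
    have h0 := hk 0
    obtain ⟨-, h1, h2⟩ := h.2
    obtain ⟨-, h1', h2'⟩ := h'.2
    have h3 : k < 1 := by
      by_contra hcon
      nlinarith
    have h4 : -1 < k := by
      by_contra hcon
      nlinarith
    obtain rfl : k = 0 := by omega
    exact Subtype.ext (funext fun a => by rw [hk a, mul_zero, add_zero])
  · rintro ⟨⟨T, hT, hTs⟩, hfix⟩
    have hfix' := (mem_fixedBy_iff _ _).1 hfix
    obtain ⟨h, H, h0, rfl⟩ := hT.exists_isHeight hdn hm (hTs ▸ hds)
    rw [hTs] at H
    obtain ⟨l, hl⟩ := (H.smul_arcsOf_eq_iff hdn hm hds n).1 hfix'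
    -- Going `d` times through the quasi-period gains `m * l * d`, which must equal the known gain
    -- `m * (d * s)`.
    have hls : l = s := by
      have e1 : ∀ i : ℕ, h (0 + n * i) = h 0 + m * l * i := by
        intro i
        induction i with
        | zero => simp
        | succ i ih =>
          push_cast
          rw [mul_add, mul_one, ← add_assoc, hl, ih]
          ring
      have e2 := e1 d
      have e3 := H.period 0
      push_cast at e3
      rw [mul_comm (d : ℤ) n, e2] at e3
      have hd' : (0 : ℤ) < d := by exact_mod_cast hd
      refine mul_left_cancel₀ (mul_pos hm' hd').ne' ?_
      linear_combination e3
    rw [hls] at hl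
    exact ⟨⟨h, ⟨H.step, hl⟩, h0⟩, rfl⟩

/-! ### Fixed points against values of the polynomial -/

/-- The height function of a fixed angulation gains some `m * l` over the short period `n`, hence `m
* l * d = m * s` over the full one. -/
theorem dvd_spokeCount_of_fixed {n m s d : ℕ} (hn : 0 < n) (hm : 0 < m) (hs : 0 < s)
    (hd : 0 < d) {T : SpokeAngulation (d * n) m s}
    (hT : T ∈ MulAction.fixedBy (SpokeAngulation (d * n) m s) (rotationGenerator (d * n) ^ n)) :
    d ∣ s := by
  have hdn := Nat.mul_pos hd hn
  have hm' : (0 : ℤ) < m := by exact_mod_cast hm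
  obtain ⟨T, hT', hTs⟩ := T
  replace hT := (mem_fixedBy_iff _ _).1 hT
  obtain ⟨h, H, -, rfl⟩ := hT'.exists_isHeight hdn hm (hTs ▸ hs)
  rw [hTs] at H
  obtain ⟨l, hl⟩ := (H.smul_arcsOf_eq_iff hdn hm hs n).1 hT
  have e1 : ∀ i : ℕ, h (0 + n * i) = h 0 + m * l * i := by
    intro i
    induction i with
    | zero => simp
    | succ i ih =>
      push_cast
      rw [mul_add, mul_one, ← add_assoc, hl, ih]
      ring
  have e3 := H.period 0
  push_cast at e3
  rw [mul_comm (d : ℤ) n, e1 d] at e3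
  have : (d : ℤ) ∣ s := ⟨l, mul_left_cancel₀ hm'.ne' (by linear_combination -e3)⟩
  exact_mod_cast this

theorem card_fixedBy_eq_aeval {n m s d : ℕ} (hn : 0 < n) (hm : 0 < m) (hs : 0 < s) (hd : 0 < d)
    (hmn : m ∣ d * n) (hcong : ¬ (s ≡ d * n / m [MOD d] ∧ ¬ s ≡ 0 [MOD d])) {ζ : ℂ}
    (hζ : IsPrimitiveRoot ζ d) :
    Polynomial.aeval ζ (spokePolynomial (d * n) m s) =
      (Nat.card (MulAction.fixedBy (SpokeAngulation (d * n) m s)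
        (rotationGenerator (d * n) ^ n)) : ℂ) := by
  obtain ⟨l, hl⟩ := hmn
  have hlm : d * n / m = l := by rw [hl, Nat.mul_div_cancel_left _ hm]
  rw [hlm] at hcong
  have hdn := Nat.mul_pos hd hn
  have hpoly : Polynomial.aeval ζ (spokePolynomial (d * n) m s) =
      if s ≤ l ∧ d ∣ l - s then ((m * n.multichoose ((l - s) / d) : ℕ) : ℂ) else 0 := by
    rw [spokePolynomial, hlm]
    by_cases hsl : s ≤ l
    · rw [if_pos hsl, show d * n + l - s - 1 = d * n - 1 + (l - s) by omega, map_mul,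
        hζ.aeval_qBinomial hd hn]
      simp only [hsl, true_and, map_natCast]
      split_ifs <;> simp
    · simp [hsl]
  rw [hpoly]
  by_cases hds : d ∣ s
  · obtain ⟨t, rfl⟩ := hds
    have ht : 0 < t := Nat.pos_of_mul_pos_left hs
    rw [← Nat.card_congr (fixedByEquiv hn hm ht hd)]
    -- Since `d * n = m * l`, such an `F` exists exactly when `d * t ≤ l` and `d ∣ l - d * t`, and
    -- then `F = (l - d * t) / d`. So both sides are nonzero in the same case.
    by_cases hF : ∃ F, n = m * (t + F)
    · obtain ⟨F, hF⟩ := hF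
      have hlF : l = d * t + d * F := by
        refine Nat.eq_of_mul_eq_mul_left hm (hl.symm.trans ?_)
        rw [hF]
        ring
      have hlF' : l - d * t = d * F := by omega
      rw [card_normalizedHeight hn hm hF, if_pos ⟨by omega, by rw [hlF']; exact dvd_mul_right _ _⟩,
        hlF', Nat.mul_div_cancel_left _ hd]
    · push Not at hF
      have := isEmpty_normalizedHeight hn hm hF
      rw [Nat.card_of_isEmpty, if_neg, Nat.cast_zero]
      rintro ⟨h1, F, h2⟩
      refine hF F (Nat.eq_of_mul_eq_mul_left hd ?_)
      rw [hl, show l = d * t + d * F by omega]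
      ring
  -- Here nothing is fixed, and the polynomial could be nonzero only if `s ≡ l` modulo `d`. This is
  -- the only use of the congruence hypothesis.
  · have : IsEmpty (MulAction.fixedBy (SpokeAngulation (d * n) m s)
        (rotationGenerator (d * n) ^ n)) :=
      ⟨fun T => hds (dvd_spokeCount_of_fixed hn hm hs hd T.2)⟩
    rw [Nat.card_of_isEmpty, if_neg, Nat.cast_zero]
    rintro ⟨h1, h2⟩
    have h3 : s ≡ l [MOD d] := (Nat.modEq_iff_dvd' h1).2 h2
    exact hcong ⟨h3, fun h4 => hds ((Nat.modEq_zero_iff_dvd).1 h4)⟩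

theorem finite_spokeAngulation {n m s : ℕ} (hn : 0 < n) (hm : 0 < m) (hs : 0 < s) :
    Finite (SpokeAngulation n m s) := by
  have := finite_normalizedHeight (s := s) hn hm
  refine Finite.of_surjective (α := NormalizedHeight n m s)
    (fun h => ⟨arcsOf n (heightEdges m h.1), h.2.1.isAngulation hn hm hs,
      h.2.1.spokeCount_arcsOf hn hm hs⟩) ?_
  rintro ⟨T, hT, hTs⟩
  obtain ⟨h, H, h0, rfl⟩ := hT.exists_isHeight hn hm (hTs ▸ hs)
  rw [hTs] at H
  exact ⟨⟨h, H, h0⟩, rfl⟩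

theorem mem_zpowers_rotationGenerator {n : ℕ} (g : RotationGroup n) :
    g ∈ Subgroup.zpowers (rotationGenerator n) := by
  obtain ⟨k, hk⟩ := ZMod.intCast_surjective g.toAdd
  refine ⟨k, Multiplicative.toAdd.injective ?_⟩
  simp [rotationGenerator, hk]

theorem orderOf_rotationGenerator (n : ℕ) : orderOf (rotationGenerator n) = n := by
  rw [rotationGenerator, orderOf_ofAdd_eq_addOrderOf, ZMod.addOrderOf_one]

/-- By Bézout, `g ^ k` and `g ^ gcd n k` are powers of each other. This reduces (a) to the rotations
by divisors of `n` treated in (b). -/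
theorem fixedBy_pow_eq_fixedBy_pow_gcd {G X : Type*} [Group G] [MulAction G X] {g : G} {n : ℕ}
    (hg : g ^ n = 1) (k : ℕ) :
    MulAction.fixedBy X (g ^ k) = MulAction.fixedBy X (g ^ n.gcd k) := by
  apply Set.Subset.antisymm
  · have h : g ^ n.gcd k = (g ^ k) ^ (n.gcdB k) := by
      rw [← zpow_natCast, Nat.gcd_eq_gcd_ab, zpow_add, zpow_mul, zpow_natCast, hg, one_zpow,
        one_mul, zpow_mul, zpow_natCast]
    rw [h]
    exact MulAction.fixedBy_subset_fixedBy_zpow X _ _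
  · obtain ⟨j, hj⟩ := Nat.gcd_dvd_right n k
    have h : g ^ k = (g ^ n.gcd k) ^ (j : ℤ) := by
      rw [zpow_natCast, ← pow_mul, ← hj]
    rw [h]
    exact MulAction.fixedBy_subset_fixedBy_zpow X _ _

theorem proposition3p11 (n m s : ℕ) (hn : 0 < n) (hm : 0 < m) (hs : 0 < s) (hmn : m ∣ n) :
    ((∀ d : ℕ, d ∣ n → s ≡ n / m [MOD d] → s ≡ 0 [MOD d]) →
      ExhibitsCSP (SpokeAngulation n m s) n (rotationGenerator n) (spokePolynomial n m s)) ∧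
    (∀ d : ℕ, d ∣ n → ¬ (s ≡ n / m [MOD d] ∧ ¬ s ≡ 0 [MOD d]) →
      ∀ ζ : ℂ, IsPrimitiveRoot ζ d →
        Polynomial.aeval ζ (spokePolynomial n m s) =
          (Nat.card (MulAction.fixedBy (SpokeAngulation n m s)
            (rotationGenerator n ^ (n / d))) : ℂ)) := by
  have hb : ∀ d : ℕ, d ∣ n → ¬ (s ≡ n / m [MOD d] ∧ ¬ s ≡ 0 [MOD d]) →
      ∀ ζ : ℂ, IsPrimitiveRoot ζ d →
        Polynomial.aeval ζ (spokePolynomial n m s) =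
          (Nat.card (MulAction.fixedBy (SpokeAngulation n m s)
            (rotationGenerator n ^ (n / d))) : ℂ) := by
    rintro d ⟨N, rfl⟩ hcong ζ hζ
    have hd : 0 < d := Nat.pos_of_mul_pos_right hn
    have hN : 0 < N := Nat.pos_of_mul_pos_left hn
    rw [Nat.mul_div_cancel_left _ hd]
    exact card_fixedBy_eq_aeval hN hm hs hd hmn hcong hζ
  refine ⟨fun hall => ⟨mem_zpowers_rotationGenerator, orderOf_rotationGenerator n,
    finite_spokeAngulation hn hm hs, fun ζ hζ k => ?_⟩, hb⟩
  have hg : 0 < n.gcd k := Nat.gcd_pos_of_pos_left k hn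
  obtain ⟨d, hd⟩ := Nat.gcd_dvd_left n k
  have hd0 : 0 < d := by
    rcases Nat.eq_zero_or_pos d with rfl | h
    · omega
    · exact h
  have hdn : n / d = n.gcd k := by
    conv_lhs => rw [hd]
    exact Nat.mul_div_cancel _ hd0
  -- The order of `ζ ^ k` is `n / gcd n k = d`, which matches the rotation by `n / d = gcd n k`.
  have hζk : IsPrimitiveRoot (ζ ^ k) d := by
    have h : orderOf (ζ ^ k) = d := by
      rw [(hζ.isOfFinOrder hn.ne').orderOf_pow, ← hζ.eq_orderOf]
      exact Nat.div_eq_of_eq_mul_right hg hd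
    exact h ▸ IsPrimitiveRoot.orderOf (ζ ^ k)
  rw [hb d ⟨n.gcd k, by rw [mul_comm]; exact hd⟩ (fun h => h.2 (hall d ⟨n.gcd k, by
    rw [mul_comm]; exact hd⟩ h.1)) _ hζk, hdn, fixedBy_pow_eq_fixedBy_pow_gcd (n := n) _ k]
  rw [← orderOf_dvd_iff_pow_eq_one, orderOf_rotationGenerator]
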